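/- Let $X$ be a uniformly convex and uniformly smooth real Banach space with $\dim X\neq 1$, with (single-valued) normalized duality map $J:X\to X^*$, $\langle x,Jx\rangle=\|x\|^2=\|Jx\|^2$, and put $\varphi(x,y)=\|x\|^2-2\langle x,Jy\rangle+\|y\|^2$. Let $\eta:(0,2]\to(0,1]$ be a modulus of uniform convexity for $X$, i.e. for all $\varepsilon\in(0,2]$ and $\|x\|,\|y\|\le 1$ with $\|x-y\|\ge\varepsilon$ one has $\|\frac{x+y}{2}\|\le 1-\eta(\varepsilon)$, and let $0<\omega(\varepsilon,b)\le\varepsilon$ be a modulus of uniform continuity of $J$ on bounded sets, i.e. $\|z\|,\|w\|\le b$ and $\|z-w\|\le\omega(\varepsilon,b)$ imply $\|Jz-Jw\|\le\varepsilon$. Let $1<L<3.18$ (for instance the constant of the Figiel inequalities). Let $T\subseteq X\times X^*$ be maximally monotone, $\mathrm{zer}\,T=\{x:(x,0)\in T\}$, with resolvents $J_rx=(J+rT)^{-1}Jx$ $(r>0)$. Let $\alpha_n\ge 0$ and $\bar\alpha$ with $\alpha_n<\bar\alpha<1$ for all $n$, let $r_n\ge\bar r>0$ for all $n$, and let $(x_n)$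 be given by the Mann-type proximal point iteration $$x_{n+1}=J^{-1}\bigl(\alpha_nJx_n+(1-\alpha_n)JJ_{r_n}x_n\bigr),\qquad x_0\in X.$$ Let $M\ge\|x_n\|$ for all $n$ and $X_0=\overline B(0,M)$. Let $z\in\mathrm{zer}\,T$ and $b\ge\varphi(z,x_0)$, let $d\in Tc$ with $C\ge\|c\|$, $D\ge\|d\|$. Let $\rho:(0,\infty)\to(0,\infty)$ be a modulus of regularity for the proximal point algorithm w.r.t. $X_0$: for all $\varepsilon>0$ and $x\in X_0$, $\|x-J_1x\|<\rho(\varepsilon)$ implies $\mathrm{dist}(x,\mathrm{Fix}\,J_1)<\varepsilon$. Define, for $\varepsilon>0$, $$\tilde\Lambda(\varepsilon)=\frac{\varepsilon}{16L^{-1}(M+1)},\quad \lambda(\varepsilon)=\frac{(M+1)^2}{L}\,\eta\Bigl(\min\Bigl\{\frac{\varepsilon}{4(M+1)},2\Bigr\}\Bigr),\quad \theta(\varepsilon)=\lambda(\varepsilon/2),\quad \rho'(\varepsilon)=\rho(\tilde\Lambda(\varepsilon/2)),$$ $$\tau(\varepsilon)=2\left\lceil\frac{b}{\lambda\bigl(\omega\bigl(\frac{\lambda(\varepsilon)}{2E},M\bigr)\bigr)(1-\bar\alpha)}\right\rceil,$$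 where $E\ge\max\{2(\mu_0+M),\,2(\bar r^{-1}\mu_0+\max\{(1+C)(\bar r^{-1}M+D)+C,\bar r^{-1}\})\}$ with $\mu_0=\max\{(1+C)(M+D)+C,1\}$. Then $(x_n)$ is Cauchy. Moreover: 1. for all $\delta>0$ and all $n,m\ge 2\tau(\rho'(\theta(\delta)/2))$: $\|x_n-x_m\|<\delta$; 2. for all $\delta>0$ such that $\delta\le 1$ or $\lambda(\delta)\le\delta$, and all $n,m\ge\mu(\delta)=2\tau(\rho'(\theta(\lambda(\delta))/2))$: $\|x_n-x_m\|<\delta$. -/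

import Mathlib

namespace MannPPA

noncomputable section

/-- `X` is uniformly smooth: `ρ_X(τ)/τ → 0` as `τ → 0+`, where
`ρ_X(τ) = sup {(‖x + y‖ + ‖x - y‖ - 2)/2 | ‖x‖ = 1, ‖y‖ ≤ τ}`. -/
def IsUniformlySmooth (X : Type*) [NormedAddCommGroup X] [NormedSpace ℝ X] : Prop :=
  ∀ ε : ℝ, 0 < ε → ∃ τ : ℝ, 0 < τ ∧
    ∀ x y : X, ‖x‖ = 1 → ‖y‖ ≤ τ → ‖x + y‖ + ‖x - y‖ ≤ 2 + ε * ‖y‖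

/-- `η : (0,2] → (0,1]` is a modulus of uniform convexity for `X`
(values of `η` outside `(0,2]` are irrelevant). -/
def IsConvexityModulus (X : Type*) [NormedAddCommGroup X] [NormedSpace ℝ X]
    (η : ℝ → ℝ) : Prop :=
  ∀ ε : ℝ, 0 < ε → ε ≤ 2 → (0 < η ε ∧ η ε ≤ 1) ∧
    ∀ x y : X, ‖x‖ ≤ 1 → ‖y‖ ≤ 1 → ε ≤ ‖x - y‖ → ‖(1 / 2 : ℝ) • (x + y)‖ ≤ 1 - η ε

section Operators

variable {X : Type*} [NormedAddCommGroup X] [NormedSpace ℝ X]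

/-- The (set-valued) normalized duality map
`{x* | ‖x‖² = ‖x*‖² = ⟨x, x*⟩}`. -/
def dualitySet (x : X) : Set (StrongDual ℝ X) :=
  {f | f x = ‖x‖ ^ 2 ∧ ‖f‖ ^ 2 = ‖x‖ ^ 2}

theorem dualitySet_nonempty (x : X) : (dualitySet x).Nonempty := by
  by_cases hx : x = 0
  · exact ⟨0, by simp [dualitySet, hx]⟩
  · obtain ⟨g, hg, hgx⟩ := exists_dual_vector ℝ x (norm_ne_zero_iff.mpr hx)
    refine ⟨‖x‖ • g, ?_, ?_⟩
    · simp only [smul_apply, hgx, smul_eq_mul]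
      norm_num
      ring
    · simp [norm_smul, hg]

/-- The duality map `J : X → X*`, a selection of `dualitySet`; in a smooth space `dualitySet x` has
exactly one element, and this is it. -/
def dualityMap (x : X) : StrongDual ℝ X := (dualitySet_nonempty x).some

/-- `φ(x, y) = ‖x‖² - 2⟨x, Jy⟩ + ‖y‖²`. -/
def phi (x y : X) : ℝ := ‖x‖ ^ 2 - 2 * dualityMap y x + ‖y‖ ^ 2

/-- A set-valued operator, given by its graph, is monotone. -/
def IsMonotoneOperator (T : Set (X × StrongDual ℝ X)) : Prop :=
  ∀ p ∈ T, ∀ q ∈ T, 0 ≤ (p.2 - q.2) (p.1 - q.1)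

/-- A monotone operator whose graph is not properly contained in the graph of another one. -/
def IsMaximallyMonotone (T : Set (X × StrongDual ℝ X)) : Prop :=
  IsMonotoneOperator T ∧
    ∀ T' : Set (X × StrongDual ℝ X), IsMonotoneOperator T' → T ⊆ T' → T' = T

/-- The zeros `{x | 0 ∈ Tx}`. -/
def zer (T : Set (X × StrongDual ℝ X)) : Set X := {x | (x, 0) ∈ T}

/-- The resolvent `J_r x = (J + rT)⁻¹ J x`: the point `u` with `Jx ∈ Ju + r Tu`. For a maximally
monotone `T` on a uniformly convex and uniformly smooth space, and `r > 0`, this point exists and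
is unique, so the choice below picks it. -/
def resolventMap (T : Set (X × StrongDual ℝ X)) (r : ℝ) (x : X) : X :=
  Classical.epsilon fun u : X =>
    ∃ v : StrongDual ℝ X, (u, v) ∈ T ∧ dualityMap u + r • v = dualityMap x

/-- The Mann-type proximal point iteration
`x_{n+1} = J⁻¹(α_n J x_n + (1 - α_n) J J_{r_n} x_n)`, with the bijection `J` applied to both
sides. -/
def IsMannPPA (T : Set (X × StrongDual ℝ X)) (α r : ℕ → ℝ) (x : ℕ → X) : Prop :=
  ∀ n : ℕ, dualityMap (x (n + 1)) =
    α n • dualityMap (x n) + (1 - α n) • dualityMap (resolventMap T (r n) (x n))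

/-- `ω` is a modulus of uniform continuity of `J` on bounded subsets, with `0 < ω(ε, b) ≤ ε`. -/
def IsDualityContinuityModulus (X : Type*) [NormedAddCommGroup X] [NormedSpace ℝ X]
    (ω : ℝ → ℝ → ℝ) : Prop :=
  ∀ ε b : ℝ, 0 < ε → 0 ≤ b → (0 < ω ε b ∧ ω ε b ≤ ε) ∧
    ∀ z w : X, ‖z‖ ≤ b → ‖w‖ ≤ b → ‖z - w‖ ≤ ω ε b → ‖dualityMap z - dualityMap w‖ ≤ ε

/-- `ρ : (0,∞) → (0,∞)` is a modulus of regularity for the proximal point algorithm of `T`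
w.r.t. `S`. -/
def IsRegularityModulus (T : Set (X × StrongDual ℝ X)) (S : Set X) (ρ : ℝ → ℝ) : Prop :=
  ∀ ε : ℝ, 0 < ε → 0 < ρ ε ∧
    ∀ x ∈ S, ‖x - resolventMap T 1 x‖ < ρ ε →
      Metric.infDist x {y | resolventMap T 1 y = y} < ε

end Operators

/-- `Λ̃(ε) = ε / (16 L⁻¹ (M + 1))`. -/
def LambdaUp (L M ε : ℝ) : ℝ := ε / (16 * L⁻¹ * (M + 1))

/-- `λ̃(ε) = ((M + 1)² / L) η(ε / (4 (M + 1)))`, the argument of `η` being capped at `2`, the right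
end of its domain. -/
def lambdaLow (η : ℝ → ℝ) (L M ε : ℝ) : ℝ :=
  (M + 1) ^ 2 / L * η (min (ε / (4 * (M + 1))) 2)

/-- `θ(ε) = λ̃(ε / 2)`. -/
def theta (η : ℝ → ℝ) (L M ε : ℝ) : ℝ := lambdaLow η L M (ε / 2)

/-- `ρ'(ε) = ρ(Λ̃(ε / 2))`. -/
def rhoPrime (ρ : ℝ → ℝ) (L M ε : ℝ) : ℝ := ρ (LambdaUp L M (ε / 2))

/-- `μ(R, b) = max {(1 + C)(b + R D) + C, 1}`. -/
def muBound (C D R b : ℝ) : ℝ := max ((1 + C) * (b + R * D) + C) 1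

/-- `τ(ε) = 2 ⌈b / (λ̃(ω(λ̃(ε) / (2E), M)) (1 - ᾱ))⌉`. -/
def tau (η : ℝ → ℝ) (ω : ℝ → ℝ → ℝ) (L M E b αbar ε : ℝ) : ℕ :=
  2 * ⌈b / (lambdaLow η L M (ω (lambdaLow η L M ε / (2 * E)) M) * (1 - αbar))⌉₊

end

end MannPPA

/-! With φ in place of the squared distance the iteration is Fejér monotone: for p ∈ zer T, φ(p,
x_{n+1}) ≤ φ(p, x_n) - (1 - α_n) φ(J_{r_n} x_n, x_n). Since φ(z, x_0) ≤ b, some early k makes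
φ(J_{r_k} x_k, x_k) small (`IsMannPPA.exists_phi_lt`). Then x_k is almost fixed by J_1
(`norm_sub_resolvent_lt`), and regularity gives y ∈ zer T close to x_k. So φ(y, x_k) is small, φ(y,
x_j) stays small for j ≥ k, and all these x_j lie close to y.

Everything rests on passing from φ to the norm: φ(u, x) < λ̃(ε) with ‖x‖ ≤ M forces ‖u - x‖ < ε
(`norm_sub_lt_of_phi_lt`). This combines the elementary bound `phi_ge` with two comparisons for η,
`IsConvexityModulus.le_sq` and `IsConvexityModulus.figiel`, which need no monotonicity of η.
Dimension one has to be excluded: on the line φ(u, x) = (u - x)², while η(ε) = ε/2 is admissible, so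
λ̃ need not be quadratically small.

Resolvents exist by Rockafellar's surjectivity theorem, obtained from the Milman–Pettis theorem by
separating convex sets. -/

namespace MannPPA

/-! ### Upper bounds for a modulus of uniform convexity. -/

section Geometry

variable {X : Type*} [NormedAddCommGroup X] [NormedSpace ℝ X]

/-- `Module.finrank` is 0 in infinite dimension, so for nontrivial X the hypothesis excludes only
the line. -/
theorem exists_linearIndependent_pair [Nontrivial X] (h : Module.finrank ℝ X ≠ 1) :
    ∃ e₁ e₂ : X, LinearIndependent ℝ ![e₁, e₂] := by
  obtain ⟨e, he⟩ := exists_ne (0 : X)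
  by_contra! hne
  refine h (finrank_eq_one e he fun w => ?_)
  by_contra! hw
  exact hne e w ((LinearIndependent.pair_iff' he).2 hw)

/-- Auerbach's lemma for a plane: two unit vectors whose coordinate functionals have norm one. -/
theorem exists_auerbach_basis_of_basis {Y : Type*} [NormedAddCommGroup Y] [NormedSpace ℝ Y]
    (B : Module.Basis (Fin 2) ℝ Y) :
    ∃ p q : Y, ‖p‖ = 1 ∧ ‖q‖ = 1 ∧
      ∀ a b : ℝ, |a| ≤ ‖a • p + b • q‖ ∧ |b| ≤ ‖a • p + b • q‖ := by
  have : FiniteDimensional ℝ Y := B.finiteDimensional_of_finite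
  have : ProperSpace Y := FiniteDimensional.proper_real Y
  let c : Fin 2 → Y →L[ℝ] ℝ := fun i => LinearMap.toContinuousLinearMap (B.coord i)
  let D : Y → Y → ℝ := fun u v => c 0 u * c 1 v - c 1 u * c 0 v
  have hDcont : Continuous fun z : Y × Y => D z.1 z.2 := by
    simp only [D]; fun_prop
  have hcB : ∀ i j, c i (B j) = if j = i then 1 else 0 := by
    intro i j
    simp [c, Module.Basis.coord_apply, Finsupp.single_apply]
  have hDadd : ∀ u v (a b : ℝ) w, D u (a • v + b • w) = a * D u v + b * D u w := by
    intro u v a b w; simp only [D, map_add, map_smul, smul_eq_mul]; ring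
  have hDswap : ∀ u v, D v u = -D u v := by intro u v; simp only [D]; ring
  have hDself : ∀ u, D u u = 0 := by intro u; simp only [D]; ring
  have hunit : ∀ v : Y, v ≠ 0 → ‖‖v‖⁻¹ • v‖ = 1 := by
    intro v hv
    rw [norm_smul, norm_inv, norm_norm, inv_mul_cancel₀ (norm_ne_zero_iff.2 hv)]
  have hB : ∀ i, B i ≠ 0 := fun i => B.ne_zero i
  have hcomp : IsCompact (Metric.sphere (0 : Y) 1 ×ˢ Metric.sphere (0 : Y) 1) :=
    (isCompact_sphere _ _).prod (isCompact_sphere _ _)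
  have hmem : (‖B 0‖⁻¹ • B 0, ‖B 1‖⁻¹ • B 1) ∈
      Metric.sphere (0 : Y) 1 ×ˢ Metric.sphere (0 : Y) 1 := by
    simp only [Set.mem_prod, mem_sphere_zero_iff_norm]
    exact ⟨hunit _ (hB 0), hunit _ (hB 1)⟩
  -- At a maximiser of the determinant on the unit spheres, `D p v / D p q` and `D v q / D p q` are
  -- the coordinates of v, and maximality bounds both by ‖v‖.
  obtain ⟨⟨p, q⟩, hpq, hmax⟩ := hcomp.exists_isMaxOn ⟨_, hmem⟩ hDcont.continuousOn
  simp only [Set.mem_prod, mem_sphere_zero_iff_norm] at hpq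
  have hle : ∀ u v : Y, ‖u‖ = 1 → ‖v‖ = 1 → D u v ≤ D p q := fun u v hu hv =>
    hmax (show (u, v) ∈ _ by simp [hu, hv])
  have hpos : 0 < D p q := by
    refine lt_of_lt_of_le ?_ (hle _ _ (hunit _ (hB 0)) (hunit _ (hB 1)))
    have h0 := norm_pos_iff.2 (hB 0)
    have h1 := norm_pos_iff.2 (hB 1)
    simp only [D, map_smul, hcB, smul_eq_mul]
    norm_num
    positivity
  have hle1 : ∀ v : Y, D p v ≤ D p q * ‖v‖ ∧ D v q ≤ D p q * ‖v‖ := by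
    intro v
    by_cases hv : v = 0
    · simp [hv, D]
    · have hv' := norm_pos_iff.2 hv
      have h1 := hle p _ hpq.1 (hunit v hv)
      have h2 := hle _ q (hunit v hv) hpq.2
      simp only [D, map_smul, smul_eq_mul] at h1 h2 ⊢
      constructor
      · have := mul_le_mul_of_nonneg_right h1 hv'.le
        field_simp at this
        linarith
      · have := mul_le_mul_of_nonneg_right h2 hv'.le
        field_simp at this
        linarith
  refine ⟨p, q, hpq.1, hpq.2, fun a b => ?_⟩
  have key : ∀ a b : ℝ, b ≤ ‖a • p + b • q‖ ∧ a ≤ ‖a • p + b • q‖ := by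
    intro a b
    obtain ⟨h1, h2⟩ := hle1 (a • p + b • q)
    rw [hDadd, hDself] at h1
    rw [hDswap q, hDadd, hDself, hDswap p q] at h2
    exact ⟨le_of_mul_le_mul_left (by linarith) hpos, le_of_mul_le_mul_left (by linarith) hpos⟩
  have hneg : ‖(-a) • p + (-b) • q‖ = ‖a • p + b • q‖ := by
    rw [← norm_neg]; congr 1; module
  have h1 := key a b
  have h2 := key (-a) (-b)
  rw [hneg] at h2
  exact ⟨abs_le.2 ⟨by linarith [h2.2], h1.2⟩, abs_le.2 ⟨by linarith [h2.1], h1.1⟩⟩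

theorem exists_auerbach_pair [Nontrivial X] (h : Module.finrank ℝ X ≠ 1) :
    ∃ p q : X, ‖p‖ = 1 ∧ ‖q‖ = 1 ∧
      ∀ a b : ℝ, |a| ≤ ‖a • p + b • q‖ ∧ |b| ≤ ‖a • p + b • q‖ := by
  obtain ⟨e₁, e₂, he⟩ := exists_linearIndependent_pair h
  obtain ⟨p, q, hp, hq, hpq⟩ := exists_auerbach_basis_of_basis (Module.Basis.span he)
  refine ⟨p, q, hp, hq, fun a b => ?_⟩
  simpa using hpq a b

/-- A weak form of Nordlander's inequality. -/
theorem IsConvexityModulus.le_sq {η : ℝ → ℝ} (hη : IsConvexityModulus X η) [Nontrivial X]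
    (h : Module.finrank ℝ X ≠ 1) {t : ℝ} (ht : 0 < t) (ht' : t ≤ 1 / 2) :
    η t ≤ 9 / 16 * t ^ 2 := by
  obtain ⟨p, q, hp, hq, hpq⟩ := exists_auerbach_pair h
  -- K is the maximum of the norm on the Euclidean unit circle in (p, q)-coordinates. Rotating the
  -- maximiser by ± arcsin t gives two points of norm at most K; their midpoint is √(1 - t²) times
  -- the maximiser and their distance is at least tK.
  obtain ⟨z, hz, hmax⟩ := (isCompact_sphere (0 : ℂ) 1).exists_isMaxOn
    ⟨1, by simp⟩ (f := fun z : ℂ => ‖z.re • p + z.im • q‖) (by fun_prop)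
  obtain ⟨a, b⟩ := z
  have hab : a ^ 2 + b ^ 2 = 1 := by
    have : Complex.normSq ⟨a, b⟩ = 1 := by
      rw [Complex.normSq_eq_norm_sq, mem_sphere_zero_iff_norm.1 hz, one_pow]
    simpa [Complex.normSq_apply, sq] using this
  have hle : ∀ a' b' : ℝ, a' ^ 2 + b' ^ 2 = 1 → ‖a' • p + b' • q‖ ≤ ‖a • p + b • q‖ := by
    intro a' b' h'
    refine hmax (show (⟨a', b'⟩ : ℂ) ∈ _ from ?_)
    rw [mem_sphere_zero_iff_norm, ← sq_eq_sq₀ (norm_nonneg _) zero_le_one,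
      ← Complex.normSq_eq_norm_sq, Complex.normSq_apply]
    nlinarith
  set K := ‖a • p + b • q‖ with hK
  have hKpos : 0 < K := by
    have h1 := (hpq a b).1
    have h2 := (hpq a b).2
    rcases (norm_nonneg (a • p + b • q)).eq_or_lt with h0 | h0
    · rw [← h0] at h1 h2
      rw [abs_nonpos_iff.1 h1, abs_nonpos_iff.1 h2] at hab
      norm_num at hab
    · exact h0
  -- The distance bound: K ≤ |a| + |b| ≤ 2 max(|a|, |b|), and the Auerbach property bounds |a| and
  -- |b| by the norm of the vector rotated by a right angle.
  have hKle : K ≤ 2 * ‖(-b) • p + a • q‖ := by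
    have h1 := (hpq (-b) a).1
    have h2 := (hpq (-b) a).2
    rw [abs_neg] at h1
    have h3 : K ≤ |a| + |b| := by
      refine (norm_add_le _ _).trans ?_
      rw [norm_smul, norm_smul, hp, hq, Real.norm_eq_abs, Real.norm_eq_abs, mul_one, mul_one]
    linarith
  set c := √(1 - t ^ 2) with hc
  have hc0 : 0 ≤ c := Real.sqrt_nonneg _
  have hcsq : c ^ 2 = 1 - t ^ 2 := Real.sq_sqrt (by nlinarith)
  have hx := hle (c * a - t * b) (c * b + t * a) (by linear_combination (c ^ 2 + t ^ 2) * hab + hcsq)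
  have hy := hle (c * a + t * b) (c * b - t * a) (by linear_combination (c ^ 2 + t ^ 2) * hab + hcsq)
  have hscale : ∀ v : X, ‖K⁻¹ • v‖ = ‖v‖ / K := by
    intro v
    rw [norm_smul, Real.norm_of_nonneg (by positivity), div_eq_inv_mul]
  have hmid := ((hη t ht (by linarith)).2
    (K⁻¹ • ((c * a - t * b) • p + (c * b + t * a) • q))
    (K⁻¹ • ((c * a + t * b) • p + (c * b - t * a) • q))
    (by rw [hscale]; exact (div_le_one hKpos).2 hx)
    (by rw [hscale]; exact (div_le_one hKpos).2 hy)
    (by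
      rw [← smul_sub, hscale, le_div_iff₀ hKpos]
      have : (c * a - t * b) • p + (c * b + t * a) • q -
          ((c * a + t * b) • p + (c * b - t * a) • q) = (2 * t) • ((-b) • p + a • q) := by module
      rw [this, norm_smul, Real.norm_of_nonneg (by positivity)]
      nlinarith))
  have hmid' : (1 / 2 : ℝ) • (K⁻¹ • ((c * a - t * b) • p + (c * b + t * a) • q) +
      K⁻¹ • ((c * a + t * b) • p + (c * b - t * a) • q)) = K⁻¹ • (c • (a • p + b • q)) := by
    module
  rw [hmid', hscale, norm_smul, Real.norm_of_nonneg hc0, ← hK, mul_div_cancel_right₀ _ hKpos.ne']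
    at hmid
  have : 1 - 9 / 16 * t ^ 2 ≤ c := by
    apply Real.le_sqrt_of_sq_le
    have ht2 : t ^ 2 ≤ 1 / 4 := by nlinarith
    nlinarith [sq_nonneg t]
  linarith

set_option maxHeartbeats 800000 in
/-- A Figiel-type comparison of the values of the modulus of convexity at different arguments. -/
theorem IsConvexityModulus.figiel {η : ℝ → ℝ} (hη : IsConvexityModulus X η) {x y : X}
    (hx : ‖x‖ ≤ 1) (hy : ‖y‖ ≤ 1) {s d t : ℝ} (hs : ‖x - y‖ = s) (hs0 : 0 < s)
    (hd : ‖(1 / 2 : ℝ) • (x + y)‖ = 1 - d) (hd0 : 0 ≤ d) (hds : d ≤ s ^ 2 / 108)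
    (ht : 0 < t) (hts : 13 * t ≤ 4 * s) :
    η t ≤ 18 * (t / s) ^ 2 * d := by
  have hs2 : s ≤ 2 := by
    rw [← hs]; exact (norm_sub_le _ _).trans (by linarith)
  have hd1 : d ≤ 1 / 27 := by nlinarith
  have hd2 : d ≤ s / 54 := by nlinarith
  set m : X := (1 / 2 : ℝ) • (x + y) with hm
  set e : X := (1 - d)⁻¹ • m with he
  set w : X := (1 / 2 : ℝ) • (y - x) with hw
  have hn : 0 < 1 - d := by linarith
  have hme : m = (1 - d) • e := by rw [he, smul_smul, mul_inv_cancel₀ hn.ne', one_smul]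
  have hnorme : ‖e‖ = 1 := by
    rw [he, norm_smul, norm_inv, Real.norm_of_nonneg hn.le, hd, inv_mul_cancel₀ hn.ne']
  have hnormw : ‖w‖ = s / 2 := by
    rw [hw, norm_smul, norm_sub_rev, hs]; norm_num; ring
  -- A parabola with apex e, in the plane of x and y. Its curvature is such that for 1/3 ≤ |ξ| ≤
  -- 10/13 it lies in the triangle 0, x, y, hence in the unit ball. So the norm on |ξ| ≤ 10/13 is
  -- maximal at some ξ₀ with |ξ₀| ≤ 1/3. The midpoint of P(ξ₀ ± σ) differs from P(ξ₀) only by 9dσ²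
  -- e; dividing by the maximum F yields η t ≤ 9dσ².
  let P : ℝ → X := fun ξ => (1 - 9 * d * ξ ^ 2) • e + ξ • w
  have hP : ∀ ξ, P ξ = (1 - 9 * d * ξ ^ 2) • e + ξ • w := fun _ => rfl
  have hcomb : ∀ β ξ : ℝ, |ξ| ≤ β → ‖β • m + ξ • w‖ ≤ β := by
    intro β ξ hξ
    have h1 := abs_le.1 hξ
    have : β • m + ξ • w = ((β - ξ) / 2) • x + ((β + ξ) / 2) • y := by rw [hm, hw]; module
    rw [this]
    refine (norm_add_le _ _).trans ?_
    rw [norm_smul, norm_smul, Real.norm_of_nonneg (by linarith),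
      Real.norm_of_nonneg (by linarith)]
    nlinarith
  obtain ⟨ξ₀, hξ₀, hmax⟩ := (isCompact_Icc (a := (-(1 / 3) : ℝ)) (b := 1 / 3)).exists_isMaxOn
    ⟨0, by norm_num⟩ (f := fun ξ => ‖P ξ‖) (by simp only [hP]; fun_prop)
  set F := ‖P ξ₀‖ with hF
  have hF1 : 1 ≤ F := by
    have h0 : ‖P 0‖ ≤ F := hmax (show (0 : ℝ) ∈ Set.Icc (-(1 / 3) : ℝ) (1 / 3) by norm_num)
    simpa [hP, hnorme] using h0
  have hξ₀' : ξ₀ ^ 2 ≤ 1 / 9 := by nlinarith [hξ₀.1, hξ₀.2]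
  have hF2 : F ≤ 1 + d := by
    have h1 := hcomb 1 ξ₀ (abs_le.2 ⟨by linarith [hξ₀.1], by linarith [hξ₀.2]⟩)
    have : P ξ₀ = ((1 : ℝ) • m + ξ₀ • w) + (d - 9 * d * ξ₀ ^ 2) • e := by
      rw [hP, hme]; module
    rw [hF, this]
    refine (norm_add_le _ _).trans ?_
    rw [norm_smul, hnorme, Real.norm_of_nonneg (by nlinarith)]
    nlinarith [mul_nonneg hd0 (sq_nonneg ξ₀)]
  have hball : ∀ ξ : ℝ, |ξ| ≤ 10 / 13 → ‖P ξ‖ ≤ F := by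
    intro ξ hξ
    rcases le_total |ξ| (1 / 3) with h1 | h1
    · exact hmax (show ξ ∈ Set.Icc (-(1 / 3) : ℝ) (1 / 3) from abs_le.1 h1)
    · have hsq : ξ ^ 2 = |ξ| ^ 2 := (sq_abs ξ).symm
      have h2 : 1 ≤ 9 * ξ ^ 2 := by rw [hsq]; nlinarith
      have h3 : ξ ^ 2 ≤ 100 / 169 := by rw [hsq]; nlinarith [abs_nonneg ξ]
      have h4 : P ξ = ((1 - 9 * d * ξ ^ 2) / (1 - d)) • m + ξ • w := by
        rw [hP, he, smul_smul, div_eq_mul_inv]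
      rw [h4]
      refine (hcomb _ _ ?_).trans (le_trans ?_ hF1)
      · rw [le_div_iff₀ hn]
        have : |ξ| * (1 - d) ≤ 10 / 13 := by nlinarith [abs_nonneg ξ]
        nlinarith [mul_nonneg hd0 (sq_nonneg ξ)]
      · rw [div_le_one hn]
        nlinarith
  -- Large enough that the two points are at distance at least 2σ(s/2 - 6d) ≥ tF, small enough that
  -- 9σ² ≤ 18(t/s)² and, by `hts`, 1/3 + σ ≤ 10/13.
  set σ := 7 * t / (5 * s) with hσ
  have hσ0 : 0 < σ := by positivity
  have hσs : σ * s = 7 / 5 * t := by rw [hσ]; field_simp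
  have hσ1 : σ ≤ 28 / 65 := by
    rw [hσ, div_le_iff₀ (by positivity)]; linarith
  have hscale : ∀ v : X, ‖F⁻¹ • v‖ = ‖v‖ / F := by
    intro v
    rw [norm_smul, Real.norm_of_nonneg (by positivity), div_eq_inv_mul]
  have hFpos : 0 < F := by linarith
  have ht2 : t ≤ 2 := by linarith
  have hmid := ((hη t ht ht2).2 (F⁻¹ • P (ξ₀ + σ)) (F⁻¹ • P (ξ₀ - σ))
    (by rw [hscale]; exact (div_le_one hFpos).2 (hball _ (abs_le.2
          ⟨by linarith [hξ₀.1], by linarith [hξ₀.2]⟩)))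
    (by rw [hscale]; exact (div_le_one hFpos).2 (hball _ (abs_le.2
          ⟨by linarith [hξ₀.1], by linarith [hξ₀.2]⟩)))
    (by
      rw [← smul_sub, hscale, le_div_iff₀ hFpos]
      have h1 : P (ξ₀ + σ) - P (ξ₀ - σ) = (2 * σ) • (w - (18 * d * ξ₀) • e) := by
        simp only [hP]; module
      have h2 : s / 2 - 6 * d ≤ ‖w - (18 * d * ξ₀) • e‖ := by
        refine le_trans ?_ (norm_sub_norm_le _ _)
        rw [hnormw, norm_smul, hnorme, Real.norm_eq_abs, abs_mul, abs_of_nonneg (by linarith)]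
        have := abs_le.2 hξ₀
        nlinarith
      rw [h1, norm_smul, Real.norm_of_nonneg (by linarith)]
      have h3 : 2 * σ * (s / 2 - 6 * d) ≤ 2 * σ * ‖w - (18 * d * ξ₀) • e‖ := by gcongr
      have h4 : 2 * σ * (7 / 18 * s) ≤ 2 * σ * (s / 2 - 6 * d) := by gcongr; linarith
      have h5 : t * F ≤ t * (1 + 1 / 27) := by gcongr; linarith
      nlinarith))
  have h1 : (1 / 2 : ℝ) • (F⁻¹ • P (ξ₀ + σ) + F⁻¹ • P (ξ₀ - σ)) =
      F⁻¹ • (P ξ₀ - (9 * d * σ ^ 2) • e) := by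
    simp only [hP]; module
  rw [h1, hscale, div_le_iff₀ hFpos] at hmid
  have h2 := (norm_sub_norm_le (P ξ₀) ((9 * d * σ ^ 2) • e)).trans hmid
  rw [norm_smul, hnorme, Real.norm_of_nonneg (by positivity), ← hF] at h2
  have h3 : η t ≤ η t * F := le_mul_of_one_le_right (hη t ht ht2).1.1.le hF1
  have h4 : 9 * d * σ ^ 2 = 9 * d * (7 / 5) ^ 2 * (t / s) ^ 2 := by
    rw [hσ]; field_simp
  have h5 : 0 ≤ d * (t / s) ^ 2 := by positivity
  nlinarith

end Geometry

/-! ### Bounding λ̃(ε) by the norm gap and the midpoint defect of the directions. -/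

section PhiLowerBound

variable {X : Type*} [NormedAddCommGroup X] [NormedSpace ℝ X]

theorem lambdaLow_le {η : ℝ → ℝ} (hη : IsConvexityModulus X η) {L M ε : ℝ} (hL : 1 < L)
    (hM : 0 ≤ M) (hε : 0 < ε) :
    lambdaLow η L M ε ≤ (M + 1) ^ 2 * η (min (ε / (4 * (M + 1))) 2) := by
  have hη0 := (hη (min (ε / (4 * (M + 1))) 2) (by positivity) (min_le_right _ _)).1.1
  rw [lambdaLow]
  have : (M + 1) ^ 2 / L ≤ (M + 1) ^ 2 := div_le_self (by positivity) hL.le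
  gcongr

theorem lambdaLow_pos {η : ℝ → ℝ} (hη : IsConvexityModulus X η) {L M ε : ℝ} (hL : 1 < L)
    (hM : 0 ≤ M) (hε : 0 < ε) : 0 < lambdaLow η L M ε := by
  have hη0 := (hη (min (ε / (4 * (M + 1))) 2) (by positivity) (min_le_right _ _)).1.1
  rw [lambdaLow]
  positivity

theorem lambdaLow_le_sq_radius {η : ℝ → ℝ} (hη : IsConvexityModulus X η) {L M ε : ℝ} (hL : 1 < L)
    (hM : 0 ≤ M) (hε : 0 < ε) : lambdaLow η L M ε ≤ (M + 1) ^ 2 := by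
  have hη1 := (hη (min (ε / (4 * (M + 1))) 2) (by positivity) (min_le_right _ _)).1.2
  refine (lambdaLow_le hη hL hM hε).trans ?_
  exact mul_le_of_le_one_right (by positivity) hη1

theorem lambdaLow_le_sq {η : ℝ → ℝ} (hη : IsConvexityModulus X η) [Nontrivial X]
    (h : Module.finrank ℝ X ≠ 1) {L M ε : ℝ} (hL : 1 < L)
    (hM : 0 ≤ M) (hε : 0 < ε) (hεM : ε ≤ 2 * (M + 1)) :
    lambdaLow η L M ε ≤ 9 / 256 * ε ^ 2 := by
  have ht : ε / (4 * (M + 1)) ≤ 1 / 2 := by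
    rw [div_le_iff₀ (by positivity)]; linarith
  refine (lambdaLow_le hη hL hM hε).trans ?_
  rw [min_eq_left (ht.trans (by norm_num))]
  refine (mul_le_mul_of_nonneg_left (hη.le_sq h (by positivity) ht) (by positivity)).trans ?_
  rw [div_pow, mul_pow]
  field_simp
  norm_num

/-- Here a, b are the norms of u, x and u', x' their directions. If |a - b| ≥ 3ε/16, then
`lambdaLow_le_sq` suffices, as (3/16)² = 9/256. Otherwise the directions differ, and either the
defect d exceeds s²/108 and is large enough by itself, or `IsConvexityModulus.figiel` applies. -/
theorem lambdaLow_le_of_small {η : ℝ → ℝ} (hη : IsConvexityModulus X η) [Nontrivial X]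
    (h : Module.finrank ℝ X ≠ 1) {L M ε : ℝ} (hL : 1 < L) (hM : 0 ≤ M) (hε : 0 < ε)
    {u' x' : X} (hun : ‖u'‖ = 1) (hxn : ‖x'‖ = 1) {a b s d : ℝ} (ha : 0 < a) (hb : 0 < b)
    (hxM : b ≤ M) (hd : ‖(1 / 2 : ℝ) • (u' + x')‖ = 1 - d) (hd0 : 0 ≤ d) (hs : ‖u' - x'‖ = s)
    (hsb : ε - |a - b| ≤ s * b) (hsa : ε - |a - b| ≤ s * a)
    (hεM : ε ≤ 2 * (M + 1)) :
    lambdaLow η L M ε ≤ (a - b) ^ 2 + 4 * (a * b) * d := by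
  have habd : 0 ≤ a * b * d := by positivity
  have hq := lambdaLow_le_sq hη h hL hM hε hεM
  rcases le_or_gt (3 / 16 * ε) |a - b| with hab' | hab'
  · have : (3 / 16 * ε) ^ 2 ≤ (a - b) ^ 2 := by
      rw [← sq_abs (a - b)]; gcongr
    nlinarith
  · have hspos : 0 < s := by
      by_contra! hs'
      nlinarith
    have hprod : (ε - |a - b|) ^ 2 ≤ s ^ 2 * (a * b) := by
      have := mul_le_mul hsb hsa (by linarith) (by positivity)
      nlinarith
    rcases le_or_gt d (s ^ 2 / 108) with hds | hds
    · set t := ε / (4 * (M + 1)) with ht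
      have ht0 : 0 < t := by positivity
      have ht1 : t ≤ 1 / 2 := by rw [ht, div_le_iff₀ (by positivity)]; linarith
      have htM : t * (4 * (M + 1)) = ε := by rw [ht]; field_simp
      have hts : 13 * t ≤ 4 * s := by
        have h1 : 13 / 16 * (t * (4 * (M + 1))) ≤ s * (M + 1) := by
          rw [htM]
          have : s * b ≤ s * (M + 1) := by gcongr; linarith
          linarith
        have h2 : (13 * t) * (M + 1) ≤ (4 * s) * (M + 1) := by linarith
        exact le_of_mul_le_mul_right h2 (by linarith)
      have hf := hη.figiel hun.le hxn.le hs hspos hd hd0 hds ht0 hts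
      have hl := lambdaLow_le hη hL hM hε
      rw [min_eq_left (ht1.trans (by norm_num))] at hl
      have h1 : (M + 1) ^ 2 * (18 * (t / s) ^ 2 * d) = 9 / 8 * d * (ε ^ 2 / s ^ 2) := by
        rw [ht]; field_simp; ring
      have h2 : (13 / 16 * ε) ^ 2 ≤ s ^ 2 * (a * b) := by
        refine le_trans ?_ hprod
        gcongr
        linarith
      have h3 : ε ^ 2 / s ^ 2 ≤ 256 / 169 * (a * b) := by
        rw [div_le_iff₀ (by positivity)]; linarith
      have h4 : (M + 1) ^ 2 * η t ≤ 9 / 8 * d * (256 / 169 * (a * b)) := by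
        refine (mul_le_mul_of_nonneg_left hf (by positivity)).trans ?_
        rw [h1]
        gcongr
      nlinarith [sq_nonneg (a - b)]
    · have h1 : s ^ 2 * (a * b) ≤ 108 * d * (a * b) := by
        gcongr; linarith
      have h2 := sq_abs (a - b)
      -- Here 4abd ≥ (ε - |a - b|)²/27. The sum (a - b)² + (ε - |a - b|)²/27 is least at |a - b| =
      -- ε/28, with value ε²/28 ≥ 9ε²/256.
      nlinarith [sq_nonneg (28 * |a - b| - ε)]

/-- Now a is much larger than M. Either a - b ≥ M + 1, which beats λ̃ ≤ (M + 1)², or s ≥ ε/(4(M +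
1)), so that η applies to the directions themselves, with 4ab ≥ (M + 1)². As s ≤ 2, the cap in
`lambdaLow` is then inactive. -/
theorem lambdaLow_le_of_large {η : ℝ → ℝ} (hη : IsConvexityModulus X η)
    {L M ε : ℝ} (hL : 1 < L) (hM : 0 ≤ M) (hε : 0 < ε)
    {u' x' : X} (hun : ‖u'‖ = 1) (hxn : ‖x'‖ = 1) {a b s d : ℝ} (ha : 0 < a) (hb : 0 < b)
    (hxM : b ≤ M) (hd : ‖(1 / 2 : ℝ) • (u' + x')‖ = 1 - d) (hd0 : 0 ≤ d) (hs : ‖u' - x'‖ = s)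
    (hsb : ε - |a - b| ≤ s * b)
    (hab : ε ≤ a + b) (hεM : 2 * (M + 1) < ε) :
    lambdaLow η L M ε ≤ (a - b) ^ 2 + 4 * (a * b) * d := by
  have habd : 0 ≤ a * b * d := by positivity
  have hs2 : s ≤ 2 := by rw [← hs]; exact (norm_sub_le _ _).trans (by linarith)
  rcases le_or_gt (M + 1) (a - b) with hab' | hab'
  · have h1 := lambdaLow_le_sq_radius hη hL hM hε
    have : (M + 1) ^ 2 ≤ (a - b) ^ 2 := by gcongr
    linarith
  · have hl := lambdaLow_le hη hL hM hε
    have habs : |a - b| = a - b := abs_of_nonneg (by linarith)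
    rw [habs] at hsb
    set t := ε / (4 * (M + 1)) with ht
    have ht0 : 0 < t := by positivity
    have htM : t * (4 * (M + 1)) = ε := by rw [ht]; field_simp
    have ht1 : 1 / 2 < t := by rw [ht, lt_div_iff₀ (by positivity)]; linarith
    have hspos : 0 < s := by
      by_contra! hs'
      nlinarith
    have hts : t ≤ s := by
      have h2 : s * b ≤ s * (M + 1) := by gcongr; linarith
      have h3 : (4 * t - 1) * (M + 1) ≤ s * (M + 1) := by linarith
      have h4 := le_of_mul_le_mul_right h3 (by linarith)
      linarith
    rw [min_eq_left (hts.trans hs2)] at hl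
    have hm := (hη t ht0 (hts.trans hs2)).2 u' x' hun.le hxn.le (by rw [hs]; exact hts)
    rw [hd] at hm
    have hdη : η t ≤ d := by linarith
    have h5 : (M + 1) ^ 2 ≤ 4 * (a * b) := by nlinarith
    have h6 : (M + 1) ^ 2 * η t ≤ 4 * (a * b) * d := by
      have := (hη t ht0 (hts.trans hs2)).1.1
      gcongr
    nlinarith [sq_nonneg (a - b)]

theorem lambdaLow_le_of_le_norm_sub {η : ℝ → ℝ} (hη : IsConvexityModulus X η) [Nontrivial X]
    (h : Module.finrank ℝ X ≠ 1) {L M ε : ℝ} (hL : 1 < L) (hM : 0 ≤ M) (hε : 0 < ε)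
    {u x : X} (hu : u ≠ 0) (hx : x ≠ 0) (hxM : ‖x‖ ≤ M) (hux : ε ≤ ‖u - x‖) :
    lambdaLow η L M ε ≤ (‖u‖ - ‖x‖) ^ 2 +
      4 * (‖u‖ * ‖x‖) * (1 - ‖(1 / 2 : ℝ) • (‖u‖⁻¹ • u + ‖x‖⁻¹ • x)‖) := by
  have ha := norm_pos_iff.2 hu
  have hb := norm_pos_iff.2 hx
  set u' := ‖u‖⁻¹ • u with hu'
  set x' := ‖x‖⁻¹ • x with hx'
  have hun : ‖u'‖ = 1 := by rw [hu', norm_smul, norm_inv, norm_norm, inv_mul_cancel₀ ha.ne']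
  have hxn : ‖x'‖ = 1 := by rw [hx', norm_smul, norm_inv, norm_norm, inv_mul_cancel₀ hb.ne']
  have huu : u = ‖u‖ • u' := by rw [hu', smul_smul, mul_inv_cancel₀ ha.ne', one_smul]
  have hxx : x = ‖x‖ • x' := by rw [hx', smul_smul, mul_inv_cancel₀ hb.ne', one_smul]
  have hab : ε ≤ ‖u‖ + ‖x‖ := hux.trans (norm_sub_le _ _)
  generalize ‖u‖ = a at *
  generalize ‖x‖ = b at *
  obtain ⟨d, hd⟩ : ∃ d, ‖(1 / 2 : ℝ) • (u' + x')‖ = 1 - d := ⟨_, (sub_sub_cancel 1 _).symm⟩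
  have hd0 : 0 ≤ d := by
    have : ‖(1 / 2 : ℝ) • (u' + x')‖ ≤ 1 := by
      rw [norm_smul]
      have := norm_add_le u' x'
      norm_num
      linarith
    linarith
  obtain ⟨s, hs⟩ : ∃ s, ‖u' - x'‖ = s := ⟨_, rfl⟩
  have hsb : ε - |a - b| ≤ s * b := by
    have h1 : u - x = b • (u' - x') + (a - b) • u' := by
      rw [huu, hxx]; module
    rw [h1] at hux
    have := hux.trans (norm_add_le _ _)
    rw [norm_smul, norm_smul, hun, hs, Real.norm_of_nonneg hb.le, Real.norm_eq_abs] at this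
    linarith
  have hsa : ε - |a - b| ≤ s * a := by
    have h1 : u - x = a • (u' - x') + (a - b) • x' := by
      rw [huu, hxx]; module
    rw [h1] at hux
    have := hux.trans (norm_add_le _ _)
    rw [norm_smul, norm_smul, hxn, hs, Real.norm_of_nonneg ha.le, Real.norm_eq_abs] at this
    linarith
  rw [hd, sub_sub_cancel]
  rcases le_or_gt ε (2 * (M + 1)) with hεM | hεM
  · exact lambdaLow_le_of_small hη h hL hM hε hun hxn ha hb hxM hd hd0 hs hsb hsa hεM
  · exact lambdaLow_le_of_large hη hL hM hε hun hxn ha hb hxM hd hd0 hs hsb hab hεM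

end PhiLowerBound

/-! ### The duality map and the functional φ. -/

section Duality

variable {X : Type*} [NormedAddCommGroup X] [NormedSpace ℝ X]

theorem dualityMap_apply_self (x : X) : dualityMap x x = ‖x‖ ^ 2 :=
  (dualitySet_nonempty x).some_mem.1

theorem norm_dualityMap (x : X) : ‖dualityMap x‖ = ‖x‖ :=
  (sq_eq_sq₀ (norm_nonneg _) (norm_nonneg _)).1 (dualitySet_nonempty x).some_mem.2

theorem dualityMap_apply_le (x y : X) : dualityMap x y ≤ ‖x‖ * ‖y‖ := by
  rw [← norm_dualityMap x]
  exact (le_abs_self _).trans ((dualityMap x).le_opNorm y)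

/-- Evaluate f at x/‖x‖ + hy and g at x/‖x‖ - hy and add: smoothness leaves h(f y - g y) ≤ hε. -/
theorem IsUniformlySmooth.eq_of_mem_dualitySet (hX : IsUniformlySmooth X) {x : X}
    {f g : StrongDual ℝ X} (hf : f ∈ dualitySet x) (hg : g ∈ dualitySet x) : f = g := by
  have hnorm : ∀ k ∈ dualitySet x, ‖k‖ = ‖x‖ := fun k hk =>
    (sq_eq_sq₀ (norm_nonneg _) (norm_nonneg _)).1 hk.2
  have hf' := hnorm f hf
  have hg' := hnorm g hg
  by_cases hx : x = 0
  · rw [hx, norm_zero] at hf' hg'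
    rw [norm_eq_zero.1 hf', norm_eq_zero.1 hg']
  have hxpos := norm_pos_iff.2 hx
  have key : ∀ y : X, f y - g y ≤ 0 := by
    intro y
    by_cases hy : y = 0
    · simp [hy]
    have hypos := norm_pos_iff.2 hy
    refine le_of_forall_pos_le_add fun ε hε => ?_
    rw [zero_add]
    obtain ⟨τ, hτ, hsm⟩ := hX (ε / (‖x‖ * ‖y‖)) (by positivity)
    set h := τ / ‖y‖ with hh
    have hhpos : 0 < h := by positivity
    have hhy : ‖h • y‖ = h * ‖y‖ := by rw [norm_smul, Real.norm_of_nonneg hhpos.le]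
    have h0 := hsm (‖x‖⁻¹ • x) (h • y)
      (by rw [norm_smul, norm_inv, norm_norm, inv_mul_cancel₀ hxpos.ne'])
      (by rw [hhy, hh]; field_simp; exact le_rfl)
    have h1 : f (‖x‖⁻¹ • x + h • y) ≤ ‖x‖ * ‖‖x‖⁻¹ • x + h • y‖ := by
      rw [← hf']; exact (le_abs_self _).trans (f.le_opNorm _)
    have h2 : g (‖x‖⁻¹ • x - h • y) ≤ ‖x‖ * ‖‖x‖⁻¹ • x - h • y‖ := by
      rw [← hg']; exact (le_abs_self _).trans (g.le_opNorm _)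
    rw [map_add, map_smul, map_smul, hf.1, smul_eq_mul, smul_eq_mul] at h1
    rw [map_sub, map_smul, map_smul, hg.1, smul_eq_mul, smul_eq_mul] at h2
    have h3 : ‖x‖⁻¹ * ‖x‖ ^ 2 = ‖x‖ := by field_simp
    rw [h3] at h1 h2
    have h4 := mul_le_mul_of_nonneg_left h0 hxpos.le
    rw [hhy] at h4
    have h5 : ‖x‖ * (2 + ε / (‖x‖ * ‖y‖) * (h * ‖y‖)) = 2 * ‖x‖ + ε * h := by field_simp
    rw [h5] at h4
    have h6 : h * (f y - g y) ≤ h * ε := by linarith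
    exact le_of_mul_le_mul_left h6 hhpos
  ext y
  have h1 := key y
  have h2 := key (-y)
  rw [map_neg, map_neg] at h2
  linarith

theorem IsUniformlySmooth.dualityMap_eq (hX : IsUniformlySmooth X) {x : X} {f : StrongDual ℝ X}
    (hf : f ∈ dualitySet x) : dualityMap x = f :=
  hX.eq_of_mem_dualitySet (dualitySet_nonempty x).some_mem hf

theorem IsUniformlySmooth.dualityMap_smul (hX : IsUniformlySmooth X) (k : ℝ) (x : X) :
    dualityMap (k • x) = k • dualityMap x := by
  refine hX.dualityMap_eq ⟨?_, ?_⟩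
  · rw [smul_apply, map_smul, dualityMap_apply_self, norm_smul, Real.norm_eq_abs, mul_pow, sq_abs,
      smul_eq_mul, smul_eq_mul]
    ring
  · rw [norm_smul, norm_smul, norm_dualityMap]

theorem phi_nonneg (x y : X) : 0 ≤ phi x y := by
  have := dualityMap_apply_le y x
  rw [phi]
  nlinarith [sq_nonneg (‖x‖ - ‖y‖)]

theorem sq_norm_sub_norm_le_phi (x y : X) : (‖x‖ - ‖y‖) ^ 2 ≤ phi x y := by
  have := dualityMap_apply_le y x
  rw [phi]
  nlinarith

/-- From φ(y, x) = ‖y‖² - ‖x‖² + 2⟨x - y, Jx⟩; it turns closeness in norm into closeness in φ. -/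
theorem phi_le (y x : X) : phi y x ≤ (‖y‖ + 3 * ‖x‖) * ‖x - y‖ := by
  have h1 : dualityMap x (x - y) ≤ ‖x‖ * ‖x - y‖ := dualityMap_apply_le _ _
  rw [map_sub, dualityMap_apply_self] at h1
  have h2 : ‖y‖ - ‖x‖ ≤ ‖x - y‖ := by rw [norm_sub_rev]; exact norm_sub_norm_le y x
  have h3 : (‖y‖ + ‖x‖) * (‖y‖ - ‖x‖) ≤ (‖y‖ + ‖x‖) * ‖x - y‖ := by gcongr
  rw [phi]
  nlinarith

theorem phi_add_phi (x y : X) :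
    phi x y + phi y x = 2 * (dualityMap x - dualityMap y) (x - y) := by
  simp only [phi, sub_apply, map_sub, dualityMap_apply_self]
  ring

theorem phi_three_point (p u x : X) :
    phi p x = phi p u + phi u x + 2 * (dualityMap u - dualityMap x) (p - u) := by
  simp only [phi, sub_apply, map_sub, dualityMap_apply_self]
  ring

/-- Evaluate Jx at the midpoint of the two directions. The lower bound is symmetric, so it serves
φ(x, u) as well. -/
theorem phi_ge {u x : X} (hu : u ≠ 0) (hx : x ≠ 0) :
    (‖u‖ - ‖x‖) ^ 2 +
      4 * (‖u‖ * ‖x‖) * (1 - ‖(1 / 2 : ℝ) • (‖u‖⁻¹ • u + ‖x‖⁻¹ • x)‖) ≤ phi u x := by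
  have ha := norm_pos_iff.2 hu
  have hb := norm_pos_iff.2 hx
  have h1 := dualityMap_apply_le x ((1 / 2 : ℝ) • (‖u‖⁻¹ • u + ‖x‖⁻¹ • x))
  have h2 : dualityMap x ((1 / 2 : ℝ) • (‖u‖⁻¹ • u + ‖x‖⁻¹ • x)) =
      (1 / 2) * (‖u‖⁻¹ * dualityMap x u + ‖x‖) := by
    rw [map_smul, map_add, map_smul, map_smul, dualityMap_apply_self]
    simp only [smul_eq_mul]
    field_simp
  rw [h2] at h1
  have h3 := mul_le_mul_of_nonneg_left h1 ha.le
  have h4 : ‖u‖ * (1 / 2 * (‖u‖⁻¹ * dualityMap x u + ‖x‖)) =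
      1 / 2 * (dualityMap x u + ‖u‖ * ‖x‖) := by field_simp
  rw [h4] at h3
  rw [phi]
  nlinarith

/-- Only x has to be bounded, and smallness of φ in either order is enough; both freedoms are used
later. -/
theorem norm_sub_lt_of_phi_lt {η : ℝ → ℝ}
    (hη : IsConvexityModulus X η) [Nontrivial X]
    (h : Module.finrank ℝ X ≠ 1) {L M ε : ℝ} (hL : 1 < L) (hM : 0 ≤ M) (hε : 0 < ε)
    {u x : X} (hxM : ‖x‖ ≤ M)
    (hlt : phi u x < lambdaLow η L M ε ∨ phi x u < lambdaLow η L M ε) : ‖u - x‖ < ε := by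
  by_contra! hux
  -- The zero vector has no direction, but then the gap of the norms alone is at least ε.
  have hsq : ‖u‖ = 0 ∨ ‖x‖ = 0 → lambdaLow η L M ε ≤ (‖u‖ - ‖x‖) ^ 2 := by
    intro h0
    have h1 : ε ≤ ‖u‖ + ‖x‖ := hux.trans (norm_sub_le _ _)
    have h2 : ε ^ 2 ≤ (‖u‖ - ‖x‖) ^ 2 := by
      have : (‖u‖ - ‖x‖) ^ 2 = (‖u‖ + ‖x‖) ^ 2 := by rcases h0 with h0 | h0 <;> rw [h0] <;> ring
      rw [this]
      gcongr
    rcases le_or_gt ε (2 * (M + 1)) with hεM | hεM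
    · have := lambdaLow_le_sq hη h hL hM hε hεM
      nlinarith
    · have := lambdaLow_le_sq_radius hη hL hM hε
      nlinarith
  have hux' := sq_norm_sub_norm_le_phi u x
  have hxu' := sq_norm_sub_norm_le_phi x u
  have hsymm : (‖x‖ - ‖u‖) ^ 2 = (‖u‖ - ‖x‖) ^ 2 := by ring
  by_cases hu : u = 0
  · have := hsq (Or.inl (by rw [hu, norm_zero]))
    rcases hlt with hlt | hlt <;> linarith
  by_cases hx : x = 0
  · have := hsq (Or.inr (by rw [hx, norm_zero]))
    rcases hlt with hlt | hlt <;> linarith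
  have h1 := lambdaLow_le_of_le_norm_sub hη h hL hM hε hu hx hxM hux
  have h2 := phi_ge hu hx
  have h3 := phi_ge hx hu
  rw [hsymm, mul_comm ‖x‖, add_comm (‖x‖⁻¹ • x)] at h3
  rcases hlt with hlt | hlt <;> linarith

theorem eq_of_phi_nonpos {η : ℝ → ℝ}
    (hη : IsConvexityModulus X η) [Nontrivial X]
    (h : Module.finrank ℝ X ≠ 1) {u x : X} (hux : phi u x ≤ 0) : u = x := by
  by_contra hne
  have hpos : 0 < ‖u - x‖ := norm_sub_pos_iff.2 hne
  exact lt_irrefl _ (norm_sub_lt_of_phi_lt hη h (L := 2) (M := ‖x‖) (by norm_num)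
    (norm_nonneg _) hpos le_rfl
    (Or.inl (hux.trans_lt (lambdaLow_pos hη (by norm_num) (norm_nonneg _) hpos))))

end Duality

/-! ### Goldstine and Milman–Pettis. -/

section Reflexivity

variable {X : Type*} [NormedAddCommGroup X] [NormedSpace ℝ X]

open Filter Topology

theorem exists_separating_of_notMem_closure {E F : Type*} [AddCommGroup E] [Module ℝ E]
    [AddCommGroup F] [Module ℝ F] (B : E →ₗ[ℝ] F →ₗ[ℝ] ℝ) {S : Set (WeakBilin B)}
    (hS : Convex ℝ S) {e : WeakBilin B} (he : e ∉ closure S) :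
    ∃ (f : F) (a : ℝ), (∀ s ∈ S, WeakBilin.eval B f s < a) ∧ a < WeakBilin.eval B f e := by
  obtain ⟨G, a, hG, ha⟩ := geometric_hahn_banach_closed_point hS.closure isClosed_closure he
  obtain ⟨f, rfl⟩ := LinearMap.dualEmbedding_surjective B G
  exact ⟨f, a, fun s hs => hG s (subset_closure hs), ha⟩

/-- The canonical embedding into the bidual with its weak-star topology. -/
noncomputable def toWeakBidual (X : Type*) [NormedAddCommGroup X] [NormedSpace ℝ X] :
    X →ₗ[ℝ] WeakBilin (topDualPairing ℝ (StrongDual ℝ X)) :=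
  (NormedSpace.inclusionInDoubleDual ℝ X).toLinearMap

theorem eval_toWeakBidual (x : X) (f : StrongDual ℝ X) :
    WeakBilin.eval (topDualPairing ℝ (StrongDual ℝ X)) f (toWeakBidual X x) = f x := rfl

/-- **Goldstine's theorem**: the unit ball is weak-star dense in the unit ball of the bidual. -/
theorem mem_closure_image_toWeakBidual
    (F : StrongDual ℝ (StrongDual ℝ X)) (hF : ‖F‖ ≤ 1)
    (F' : WeakBilin (topDualPairing ℝ (StrongDual ℝ X)))
    (hF' : ∀ f, WeakBilin.eval (topDualPairing ℝ (StrongDual ℝ X)) f F' = F f) :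
    F' ∈ closure (toWeakBidual X '' Metric.closedBall 0 1) := by
  by_contra hmem
  obtain ⟨f, a, hf, ha⟩ := exists_separating_of_notMem_closure _
    ((convex_closedBall (0 : X) 1).linear_image _) hmem
  rw [hF'] at ha
  replace hf : ∀ x ∈ Metric.closedBall (0 : X) 1, f x < a := fun x hx => by
    rw [← eval_toWeakBidual]
    exact hf _ ⟨x, hx, rfl⟩
  have ha0 : 0 < a := by simpa using hf 0 (by simp)
  have hfa : ‖f‖ ≤ a := by
    refine ContinuousLinearMap.opNorm_le_of_unit_norm ha0.le fun x hx => ?_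
    have h1 := hf x (by simp [hx])
    have h2 := hf (-x) (by simp [hx])
    rw [map_neg] at h2
    exact abs_le.2 ⟨by linarith, h1.le⟩
  have h1 : F f ≤ ‖F‖ * ‖f‖ := (le_abs_self _).trans (F.le_opNorm f)
  have h2 : ‖F‖ * ‖f‖ ≤ 1 * ‖f‖ := by gcongr
  linarith

theorem exists_forall_apply_eq_of_norm_eq_one [CompleteSpace X] [UniformConvexSpace X]
    (F : StrongDual ℝ (StrongDual ℝ X)) (hF : ‖F‖ = 1) :
    ∃ x : X, ∀ f : StrongDual ℝ X, F f = f x := by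
  let F' : WeakBilin (topDualPairing ℝ (StrongDual ℝ X)) := F
  have hmem := mem_closure_image_toWeakBidual F hF.le F' fun _ => rfl
  -- The traces on the unit ball of the weak-star neighbourhoods of F. If f nearly attains ‖F‖ = 1,
  -- then f(x + y) > 2 - δ for x, y in a small member, so uniform convexity makes the filter Cauchy;
  -- its limit represents F.
  let l : Filter X := comap (toWeakBidual X) (𝓝 F') ⊓ 𝓟 (Metric.closedBall 0 1)
  have hl : l.NeBot := by
    rw [← map_neBot_iff (toWeakBidual X), Filter.push_pull', map_principal]
    exact mem_closure_iff_clusterPt.1 hmem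
  have htend : ∀ f : StrongDual ℝ X, Tendsto (fun x => f x) l (𝓝 (F f)) := fun f => by
    have h1 : Tendsto (toWeakBidual X) l (𝓝 F') := tendsto_comap.mono_left inf_le_left
    exact ((WeakBilin.eval (topDualPairing ℝ (StrongDual ℝ X)) f).continuous.tendsto F').comp h1
  have hball : Metric.closedBall (0 : X) 1 ∈ l := mem_inf_of_right (mem_principal_self _)
  have hcauchy : Cauchy l := by
    refine Metric.cauchy_iff.2 ⟨hl, fun ε hε => ?_⟩
    obtain ⟨δ, hδ, hconv⟩ := exists_forall_closed_ball_dist_add_le_two_sub X hε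
    obtain ⟨f, hf, hFf⟩ : ∃ f : StrongDual ℝ X, ‖f‖ ≤ 1 ∧ 1 - δ / 2 < F f := by
      by_contra! hcon
      have : ‖F‖ ≤ max (1 - δ / 2) 0 := by
        refine ContinuousLinearMap.opNorm_le_of_unit_norm (le_max_right _ _) fun f hf => ?_
        have h1 := hcon f hf.le
        have h2 := hcon (-f) (by rw [norm_neg]; exact hf.le)
        rw [map_neg] at h2
        exact (abs_le.2 ⟨by linarith, h1⟩).trans (le_max_left _ _)
      rw [hF] at this
      rcases le_max_iff.1 this with h | h <;> linarith
    have hset : {x : X | 1 - δ / 2 < f x} ∈ l := (htend f).eventually (lt_mem_nhds hFf)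
    refine ⟨_, inter_mem hset hball, fun x hx y hy => ?_⟩
    by_contra! hxy
    rw [dist_eq_norm] at hxy
    have h1 := hconv (mem_closedBall_zero_iff.1 hx.2) (mem_closedBall_zero_iff.1 hy.2) hxy
    have h2 : f (x + y) ≤ ‖x + y‖ := by
      refine ((le_abs_self _).trans (f.le_opNorm _)).trans ?_
      exact mul_le_of_le_one_left (norm_nonneg _) hf
    have h3 : 1 - δ / 2 < f x := hx.1
    have h4 : 1 - δ / 2 < f y := hy.1
    rw [map_add] at h2
    linarith
  obtain ⟨x, hx⟩ := CompleteSpace.complete hcauchy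
  exact ⟨x, fun f => tendsto_nhds_unique (htend f) ((f.continuous.tendsto x).mono_left hx)⟩

theorem norm_inv_norm_smul {E : Type*} [NormedAddCommGroup E] [NormedSpace ℝ E] {v : E}
    (hv : ‖v‖ ≠ 0) : ‖‖v‖⁻¹ • v‖ = 1 := by
  rw [norm_smul, norm_inv, norm_norm, inv_mul_cancel₀ hv]

/-- **Milman–Pettis theorem**: a uniformly convex Banach space is reflexive. -/
theorem exists_forall_apply_eq [CompleteSpace X] [UniformConvexSpace X]
    (F : StrongDual ℝ (StrongDual ℝ X)) : ∃ x : X, ∀ f : StrongDual ℝ X, F f = f x := by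
  by_cases hF' : ‖F‖ = 0
  · refine ⟨0, fun f => ?_⟩
    have := F.le_opNorm f
    rw [hF', zero_mul] at this
    rw [map_zero, norm_le_zero_iff.1 this]
  obtain ⟨x, hx⟩ := exists_forall_apply_eq_of_norm_eq_one (‖F‖⁻¹ • F)
    (norm_inv_norm_smul (E := StrongDual ℝ (StrongDual ℝ X)) (v := F) hF')
  refine ⟨‖F‖ • x, fun f => ?_⟩
  rw [map_smul, ← hx f, smul_apply, smul_smul, mul_inv_cancel₀ hF', one_smul]

end Reflexivity

/-! ### Surjectivity of J + rT. -/

section Surjectivity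

variable {X : Type*} [NormedAddCommGroup X] [NormedSpace ℝ X]

theorem IsMaximallyMonotone.mem_of_forall {T : Set (X × StrongDual ℝ X)}
    (hT : IsMaximallyMonotone T) {p : X × StrongDual ℝ X}
    (hp : ∀ q ∈ T, 0 ≤ (p.2 - q.2) (p.1 - q.1)) : p ∈ T := by
  have : insert p T = T := by
    refine hT.2 _ ?_ (Set.subset_insert _ _)
    rintro a (rfl | ha) b (rfl | hb)
    · simp
    · exact hp b hb
    · have := hp a ha
      rw [← neg_sub a.2, ← neg_sub a.1, map_neg, neg_apply, neg_neg] at this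
      exact this
    · exact hT.1 a ha b hb
  rw [← this]
  exact Set.mem_insert _ _

/-- Monotonicity is nonnegativity of a symmetric expression affine in each of two points of the
lifted graph. It extends to the hull in one variable, then in the other; the diagonal is the claim.
-/
theorem apply_le_of_mem_convexHull {T : Set (X × StrongDual ℝ X)} (hT : IsMonotoneOperator T)
    {z : (X × StrongDual ℝ X) × ℝ}
    (hz : z ∈ convexHull ℝ ((fun p : X × StrongDual ℝ X => (p, -p.2 p.1)) '' T)) :
    z.1.2 z.1.1 ≤ -z.2 := by
  have hconv : ∀ w : (X × StrongDual ℝ X) × ℝ, Convex ℝ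
      {z : (X × StrongDual ℝ X) × ℝ | 0 ≤ -z.2 - z.1.2 w.1.1 - w.1.2 z.1.1 - w.2} := by
    intro w z hz z' hz' a b ha hb hab
    simp only [Set.mem_ofPred_eq, Prod.fst_add, Prod.snd_add, Prod.smul_fst, Prod.smul_snd,
      map_add, map_smul, add_apply, smul_apply, smul_eq_mul] at hz hz' ⊢
    have h1 := mul_nonneg ha hz
    have h2 := mul_nonneg hb hz'
    have h3 : w.2 = a * w.2 + b * w.2 := by rw [← add_mul, hab, one_mul]
    nlinarith
  have h1 : ∀ q ∈ T, ∀ z ∈ convexHull ℝ ((fun p : X × StrongDual ℝ X => (p, -p.2 p.1)) '' T),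
      0 ≤ -z.2 - z.1.2 q.1 - q.2 z.1.1 - (-q.2 q.1) := by
    intro q hq z hz
    refine convexHull_min ?_ (hconv (q, -q.2 q.1)) hz
    rintro _ ⟨p, hp, rfl⟩
    have := hT p hp q hq
    simp only [sub_apply, map_sub] at this
    simp only [Set.mem_ofPred_eq]
    linarith
  have h2 : 0 ≤ -z.2 - z.1.2 z.1.1 - z.1.2 z.1.1 - z.2 := by
    refine convexHull_min ?_ (hconv z) hz
    rintro _ ⟨p, hp, rfl⟩
    have := h1 p hp z hz
    simp only [Set.mem_ofPred_eq]
    linarith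
  linarith

theorem convexOn_half_norm_sq {E : Type*} [NormedAddCommGroup E] [NormedSpace ℝ E] :
    ConvexOn ℝ Set.univ fun x : E => 1 / 2 * ‖x‖ ^ 2 := by
  simpa using! ((convexOn_norm (convex_univ (E := E) (𝕜 := ℝ))).pow
    (fun _ _ => norm_nonneg _) 2).smul (by norm_num : (0 : ℝ) ≤ 1 / 2)

/-- **Rockafellar's theorem**: `0` lies in the range of `J + T` if `T` is maximally monotone. -/
theorem IsMaximallyMonotone.exists_dualityMap_eq_neg [CompleteSpace X] [UniformConvexSpace X]
    (hX : IsUniformlySmooth X) {T : Set (X × StrongDual ℝ X)} (hT : IsMaximallyMonotone T)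
    (hne : T.Nonempty) : ∃ p ∈ T, dualityMap p.1 = -p.2 := by
  let g : X × StrongDual ℝ X → ℝ := fun p => 1 / 2 * ‖p.1‖ ^ 2 + 1 / 2 * ‖p.2‖ ^ 2
  have hg : ConvexOn ℝ Set.univ g :=
    (convexOn_half_norm_sq.comp_linearMap (LinearMap.fst ℝ X (StrongDual ℝ X))).add
      (convexOn_half_norm_sq.comp_linearMap (LinearMap.snd ℝ X (StrongDual ℝ X)))
  have hgcont : Continuous g := by simp only [g]; fun_prop
  have hconv : Convex ℝ {z : (X × StrongDual ℝ X) × ℝ | g z.1 < z.2} := by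
    simpa using! hg.convex_strict_epigraph
  have hopen : IsOpen {z : (X × StrongDual ℝ X) × ℝ | g z.1 < z.2} :=
    isOpen_lt (hgcont.comp continuous_fst) continuous_snd
  have hneg : ∀ p : X × StrongDual ℝ X, -p.2 p.1 ≤ g p := by
    intro p
    have h1 : -p.2 p.1 ≤ ‖p.2‖ * ‖p.1‖ := (neg_le_abs _).trans (p.2.le_opNorm _)
    simp only [g]
    nlinarith [sq_nonneg (‖p.1‖ - ‖p.2‖)]
  have hdisj : Disjoint {z : (X × StrongDual ℝ X) × ℝ | g z.1 < z.2}
      (convexHull ℝ ((fun p : X × StrongDual ℝ X => (p, -p.2 p.1)) '' T)) := by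
    rw [Set.disjoint_left]
    intro z hz hz'
    have h1 := apply_le_of_mem_convexHull hT.1 hz'
    have h2 := hneg z.1
    have h3 : g z.1 < z.2 := hz
    linarith
  -- The separating functional has a component on X*, which reflexivity represents by a vector y₀.
  -- Dividing by its vertical component -k, with signs changed, gives the sought point (y, a).
  obtain ⟨S, u, hS1, hS2⟩ := geometric_hahn_banach_open hconv hopen (convex_convexHull _ _) hdisj
  obtain ⟨k, hk⟩ : ∃ k, S ((0, 0), 1) = -k := ⟨_, (neg_neg _).symm⟩
  let l : StrongDual ℝ X := (S.comp (ContinuousLinearMap.inl ℝ _ ℝ)).comp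
    (ContinuousLinearMap.inl ℝ X (StrongDual ℝ X))
  let F : StrongDual ℝ (StrongDual ℝ X) := (S.comp (ContinuousLinearMap.inl ℝ _ ℝ)).comp
    (ContinuousLinearMap.inr ℝ X (StrongDual ℝ X))
  obtain ⟨y₀, hy₀⟩ := exists_forall_apply_eq F
  have hS : ∀ x f s, S ((x, f), s) = l x + f y₀ - k * s := by
    intro x f s
    rw [← hy₀ f]
    have h1 : (((x, f), s) : (X × StrongDual ℝ X) × ℝ) =
        ((x, 0), 0) + ((0, f), 0) + s • ((0, 0), 1) := by simp
    rw [h1, map_add, map_add, map_smul, hk]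
    simp only [l, F, ContinuousLinearMap.comp_apply, ContinuousLinearMap.inl_apply,
      ContinuousLinearMap.inr_apply, smul_eq_mul]
    ring
  have hT1 : ∀ p ∈ T, u ≤ l p.1 + p.2 y₀ + k * p.2 p.1 := by
    intro p hp
    have := hS2 _ (subset_convexHull ℝ _ ⟨p, hp, rfl⟩)
    rw [show ((fun p : X × StrongDual ℝ X => (p, -p.2 p.1)) p) = ((p.1, p.2), -p.2 p.1) from rfl,
      hS] at this
    linarith
  have hA : ∀ x f s, g (x, f) < s → l x + f y₀ - k * s < u := by
    intro x f s hs
    rw [← hS]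
    exact hS1 _ hs
  have hkpos : 0 < k := by
    obtain ⟨q, hq⟩ := hne
    have h1 := hT1 q hq
    have h2 := hA q.1 q.2 (g q + 1) (lt_add_one _)
    have h3 := hneg q
    by_contra! hk0
    nlinarith
  have hA' : ∀ x f, l x + f y₀ - k * g (x, f) ≤ u := by
    intro x f
    refine le_of_forall_pos_le_add fun ε hε => ?_
    have h1 := hA x f (g (x, f) + ε / k) (by linarith [div_pos hε hkpos])
    rw [mul_add, mul_div_cancel₀ _ hkpos.ne'] at h1
    linarith
  obtain ⟨a, ha⟩ : ∃ a : StrongDual ℝ X, a = -(k⁻¹ • l) := ⟨_, rfl⟩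
  obtain ⟨y, hy⟩ : ∃ y : X, y = -(k⁻¹ • y₀) := ⟨_, rfl⟩
  have hl : ∀ x, l x = -(k * a x) := by
    intro x
    rw [ha, neg_apply, smul_apply, smul_eq_mul]
    field_simp
  have hy0 : ∀ f : StrongDual ℝ X, f y₀ = -(k * f y) := by
    intro f
    rw [hy, map_neg, map_smul, smul_eq_mul]
    field_simp
  obtain ⟨β, hβ⟩ : ∃ β, u = k * β := ⟨u / k, by field_simp⟩
  have hT2 : ∀ p ∈ T, β ≤ p.2 p.1 - a p.1 - p.2 y := by
    intro p hp
    have := hT1 p hp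
    rw [hl, hy0, hβ] at this
    refine le_of_mul_le_mul_left ?_ hkpos
    linarith
  have hA2 : ∀ (x : X) (f : StrongDual ℝ X),
      -a x - f y - (1 / 2 * ‖x‖ ^ 2 + 1 / 2 * ‖f‖ ^ 2) ≤ β := by
    intro x f
    have := hA' x f
    rw [hl, hy0, hβ] at this
    refine le_of_mul_le_mul_left ?_ hkpos
    simp only [g] at this
    linarith
  have hβy : ∀ x, -a x + 1 / 2 * ‖y‖ ^ 2 - 1 / 2 * ‖x‖ ^ 2 ≤ β := by
    intro x
    have := hA2 x (-dualityMap y)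
    rw [neg_apply, dualityMap_apply_self, norm_neg, norm_dualityMap] at this
    linarith
  -- The choice f = -Jy, x = y in `hA2` gives β ≥ -a(y), which makes (y, a) monotonically related to
  -- all of T.
  have hmem : (y, a) ∈ T := by
    refine hT.mem_of_forall fun q hq => ?_
    have h1 := hT2 q hq
    have h2 := hβy y
    simp only [sub_apply, map_sub]
    linarith
  refine ⟨_, hmem, hX.dualityMap_eq ?_⟩
  have h1 := hT2 _ hmem
  -- x₀ represents the duality map of X* at a. Testing with -x₀ gives ½‖a‖² + ½‖y‖² ≤ β ≤ -a(y) ≤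
  -- ‖a‖‖y‖, so equality holds throughout and -a = Jy.
  obtain ⟨x₀, hx₀⟩ := exists_forall_apply_eq (dualityMap a)
  have hx₀' : NormedSpace.inclusionInDoubleDual ℝ X x₀ = dualityMap a := by
    ext f
    rw [NormedSpace.dual_def, hx₀]
  have hnx₀ : ‖x₀‖ = ‖a‖ := by
    rw [← norm_dualityMap a, ← hx₀']
    exact ((NormedSpace.inclusionInDoubleDualLi (E := X) ℝ).norm_map x₀).symm
  have h2 := hβy (-x₀)
  rw [map_neg, neg_neg, norm_neg, hnx₀, ← hx₀ a, dualityMap_apply_self] at h2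
  have h3 : -a y ≤ ‖a‖ * ‖y‖ := (neg_le_abs _).trans (a.le_opNorm _)
  simp only at h1
  have h4 : ‖a‖ = ‖y‖ := by nlinarith [sq_nonneg (‖a‖ - ‖y‖)]
  rw [h4] at h2 h3
  refine ⟨?_, by rw [norm_neg, h4]⟩
  simp only [neg_apply]
  linarith

/-- Rockafellar's theorem for rT - w, which is again maximally monotone. -/
theorem IsMaximallyMonotone.exists_resolvent [CompleteSpace X] [UniformConvexSpace X]
    (hX : IsUniformlySmooth X) {T : Set (X × StrongDual ℝ X)} (hT : IsMaximallyMonotone T)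
    (hne : T.Nonempty) {r : ℝ} (hr : 0 < r) (w : StrongDual ℝ X) :
    ∃ u v, (u, v) ∈ T ∧ dualityMap u + r • v = w := by
  let T' : Set (X × StrongDual ℝ X) := (fun p => (p.1, r • p.2 - w)) '' T
  have hmono : IsMonotoneOperator T' := by
    rintro _ ⟨p, hp, rfl⟩ _ ⟨q, hq, rfl⟩
    have h1 := hT.1 p hp q hq
    have h2 : r • p.2 - w - (r • q.2 - w) = r • (p.2 - q.2) := by module
    simp only [h2, smul_apply, smul_eq_mul]
    positivity
  have hmax : IsMaximallyMonotone T' := by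
    refine ⟨hmono, fun S hS hTS => Set.Subset.antisymm (fun s hs => ?_) hTS⟩
    refine ⟨(s.1, r⁻¹ • (s.2 + w)), hT.mem_of_forall fun q hq => ?_, ?_⟩
    · have h1 := hS s hs _ (hTS ⟨q, hq, rfl⟩)
      have h2 : r⁻¹ • (s.2 + w) - q.2 = r⁻¹ • (s.2 - (r • q.2 - w)) := by
        rw [smul_sub, smul_sub, smul_smul, inv_mul_cancel₀ hr.ne']; module
      simp only [h2, smul_apply, smul_eq_mul]
      exact mul_nonneg (by positivity) h1
    · simp [smul_smul, mul_inv_cancel₀ hr.ne']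
  obtain ⟨_, ⟨p, hp, rfl⟩, h⟩ := hmax.exists_dualityMap_eq_neg hX (hne.image _)
  exact ⟨p.1, p.2, hp, by simp only at h; rw [h]; module⟩

end Surjectivity

/-! ### Estimates for resolvents. -/

section Resolvent

variable {X : Type*} [NormedAddCommGroup X] [NormedSpace ℝ X]

/-- In the three-point identity the cross term is nonnegative by monotonicity between u and the zero
p. -/
theorem phi_add_phi_le {T : Set (X × StrongDual ℝ X)} (hT : IsMonotoneOperator T) {r : ℝ}
    (hr : 0 < r) {u p x : X} {v : StrongDual ℝ X} (huv : (u, v) ∈ T)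
    (hux : dualityMap u + r • v = dualityMap x) (hp : p ∈ zer T) :
    phi p u + phi u x ≤ phi p x := by
  have h1 := hT _ huv _ hp
  have h2 : dualityMap u - dualityMap x = -(r • v) := by rw [← hux]; module
  rw [phi_three_point p u x, h2]
  simp only [sub_zero, neg_apply, smul_apply, smul_eq_mul, map_sub] at h1 ⊢
  nlinarith [mul_nonneg hr.le h1]

/-- In the variable Jx, φ(p, ·) is an affine function plus a squared norm, hence convex. -/
theorem phi_le_of_dualityMap_eq {a : ℝ} (ha0 : 0 ≤ a) (ha1 : a ≤ 1) {p x u x' : X}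
    (h : dualityMap x' = a • dualityMap x + (1 - a) • dualityMap u) :
    phi p x' ≤ a * phi p x + (1 - a) * phi p u := by
  have h1 : ‖x'‖ ≤ a * ‖x‖ + (1 - a) * ‖u‖ := by
    rw [← norm_dualityMap x', h]
    refine (norm_add_le _ _).trans ?_
    rw [norm_smul, norm_smul, norm_dualityMap, norm_dualityMap, Real.norm_of_nonneg ha0,
      Real.norm_of_nonneg (by linarith)]
  have h2 : ‖x'‖ ^ 2 ≤ (a * ‖x‖ + (1 - a) * ‖u‖) ^ 2 := by gcongr
  have h3 : 0 ≤ a * (1 - a) * (‖x‖ - ‖u‖) ^ 2 := by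
    have : 0 ≤ 1 - a := by linarith
    positivity
  simp only [phi, h, add_apply, smul_apply, smul_eq_mul]
  nlinarith

/-- Here w plays the role of J_1 x. Monotonicity against (c, d) gives ‖w‖² ≤ ‖w‖(M + D + C) + C(M +
D), which bounds ‖w‖ once ‖w‖ > 1. -/
theorem norm_le_muBound {T : Set (X × StrongDual ℝ X)} (hT : IsMonotoneOperator T)
    {w x c : X} {d : StrongDual ℝ X} (hw : (w, dualityMap x - dualityMap w) ∈ T)
    (hcd : (c, d) ∈ T) {C D M : ℝ} (hC : ‖c‖ ≤ C) (hD : ‖d‖ ≤ D) (hx : ‖x‖ ≤ M) :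
    ‖w‖ ≤ muBound C D 1 M := by
  have h := hT _ hw _ hcd
  simp only [sub_apply, map_sub, dualityMap_apply_self] at h
  have hW := norm_nonneg w
  have hC0 := (norm_nonneg c).trans hC
  have hD0 := (norm_nonneg d).trans hD
  have hM0 := (norm_nonneg x).trans hx
  have h1 : dualityMap x w ≤ M * ‖w‖ := (dualityMap_apply_le x w).trans (by gcongr)
  have h2 : -d w ≤ D * ‖w‖ := by
    refine ((neg_le_abs _).trans (d.le_opNorm w)).trans (by gcongr)
  have h3 : -dualityMap x c ≤ M * C := by
    refine ((neg_le_abs _).trans ((dualityMap x).le_opNorm c)).trans ?_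
    rw [norm_dualityMap]; gcongr
  have h4 : dualityMap w c ≤ ‖w‖ * C := (dualityMap_apply_le w c).trans (by gcongr)
  have h5 : d c ≤ D * C := ((le_abs_self _).trans (d.le_opNorm c)).trans (by gcongr)
  have h6 : ‖w‖ ^ 2 ≤ ‖w‖ * (M + D + C) + C * (M + D) := by nlinarith
  rw [muBound, le_max_iff]
  by_contra! hcon
  have h7 : 0 ≤ C * (M + D) := by positivity
  have h8 : ‖w‖ * ((1 + C) * (M + D) + C) < ‖w‖ * ‖w‖ := by
    have := hcon.1
    rw [one_mul] at this
    exact mul_lt_mul_of_pos_left this (by linarith [hcon.2])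
  nlinarith [mul_le_mul_of_nonneg_right hcon.2.le h7]

/-- If `φ(u, x)` is small then `Ju` and `Jx` are close, even if `u` leaves the ball on which the
modulus of continuity of `J` is applied. -/
theorem norm_dualityMap_sub_le_of_phi_lt (hX : IsUniformlySmooth X) {η : ℝ → ℝ}
    (hη : IsConvexityModulus X η) [Nontrivial X] (h : Module.finrank ℝ X ≠ 1)
    {ω : ℝ → ℝ → ℝ} (hω : IsDualityContinuityModulus X ω) {L M ε : ℝ} (hL : 1 < L)
    (hM : 0 ≤ M) (hε : 0 < ε) {u x : X} (hx : ‖x‖ ≤ M)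
    (hux : phi u x < lambdaLow η L M (ω ε M)) : ‖dualityMap u - dualityMap x‖ ≤ 2 * ε := by
  obtain ⟨⟨hω0, hωε⟩, hωJ⟩ := hω ε M hε hM
  have hdist := norm_sub_lt_of_phi_lt hη h hL hM hω0 hx (Or.inl hux)
  rcases le_or_gt ‖u‖ M with hu | hu
  · linarith [hωJ u x hu hx hdist.le]
  have hupos : 0 < ‖u‖ := hM.trans_lt hu
  -- Scaling u back to norm M does not increase φ(·, x), and changes Ju by ‖u‖ - M ≤ ‖u - x‖ in
  -- norm.
  set k := M / ‖u‖ with hk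
  have hk0 : 0 ≤ k := by positivity
  have hk1 : k < 1 := (div_lt_one hupos).2 hu
  have hku : k * ‖u‖ = M := by rw [hk]; field_simp
  have hnorm : ‖k • u‖ = M := by rw [norm_smul, Real.norm_of_nonneg hk0, hku]
  have hphi : phi (k • u) x ≤ phi u x := by
    have h1 := dualityMap_apply_le x u
    have h2 : ‖x‖ * ‖u‖ ≤ k * ‖u‖ * ‖u‖ := by rw [hku]; gcongr
    rw [phi, phi, hnorm, map_smul, smul_eq_mul, ← hku]
    have h3 : 0 ≤ (1 - k) * ((1 + k) * ‖u‖ ^ 2 - 2 * dualityMap x u) := by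
      refine mul_nonneg (by linarith) ?_
      nlinarith [mul_nonneg (sub_nonneg.2 hk1.le) (sq_nonneg ‖u‖)]
    nlinarith
  have hdist' := norm_sub_lt_of_phi_lt hη h hL hM hω0 hx (Or.inl (hphi.trans_lt hux))
  have h1 := hωJ (k • u) x hnorm.le hx hdist'.le
  have h2 : ‖dualityMap u - dualityMap (k • u)‖ ≤ ε := by
    have : dualityMap u - dualityMap (k • u) = (1 - k) • dualityMap u := by
      rw [hX.dualityMap_smul]; module
    rw [this, norm_smul, norm_dualityMap, Real.norm_of_nonneg (by linarith), sub_mul, one_mul, hku]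
    linarith [norm_sub_norm_le u x]
  calc ‖dualityMap u - dualityMap x‖
      = ‖(dualityMap u - dualityMap (k • u)) + (dualityMap (k • u) - dualityMap x)‖ := by
        rw [sub_add_sub_cancel]
    _ ≤ 2 * ε := (norm_add_le _ _).trans (by linarith)

/-- A point with small `φ(J_r x, x)` is almost fixed by `J_1`. -/
theorem norm_sub_resolvent_lt (hX : IsUniformlySmooth X) {η : ℝ → ℝ}
    (hη : IsConvexityModulus X η) [Nontrivial X] (h : Module.finrank ℝ X ≠ 1)
    {ω : ℝ → ℝ → ℝ} (hω : IsDualityContinuityModulus X ω)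
    {T : Set (X × StrongDual ℝ X)} (hT : IsMonotoneOperator T)
    {L M E K ε r rbar : ℝ} (hL : 1 < L) (hM : 0 ≤ M) (hε : 0 < ε) (hrbar : 0 < rbar)
    (hr : rbar ≤ r) (hK : 1 ≤ K) (hE₁ : 2 * (K + M) ≤ E) (hE₂ : 2 * (rbar⁻¹ * (K + M)) ≤ E)
    {u w x : X} {v : StrongDual ℝ X} (hx : ‖x‖ ≤ M) (huv : (u, v) ∈ T)
    (hux : dualityMap u + r • v = dualityMap x) (hw : (w, dualityMap x - dualityMap w) ∈ T)
    (hwK : ‖w‖ ≤ K)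
    (hphi : phi u x < lambdaLow η L M (ω (lambdaLow η L M ε / (2 * E)) M)) : ‖x - w‖ < ε := by
  have hEpos : 0 < E := by linarith
  have hl := lambdaLow_pos hη hL hM hε
  have hl' := lambdaLow_le_sq_radius hη hL hM hε
  set l := lambdaLow η L M ε with hldef
  set κ := l / (2 * E) with hκ
  have hκ0 : 0 < κ := by positivity
  have hκE : κ * (2 * E) = l := by rw [hκ]; field_simp
  obtain ⟨⟨hω0, hωκ⟩, -⟩ := hω κ M hκ0 hM
  have hdist := norm_sub_lt_of_phi_lt hη h hL hM hω0 hx (Or.inl hphi)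
  have hJ := norm_dualityMap_sub_le_of_phi_lt hX hη h hω hL hM hκ0 hx hphi
  -- From λ̃ ≤ (M + 1)² ≤ (K + M)² and E ≥ 2(K + M); it gives ‖u - w‖ ≤ 5/4 (K + M) below.
  have hκ4 : κ ≤ (K + M) / 4 := by
    have h1 : κ * (2 * E) ≤ (K + M) / 4 * (2 * E) := by
      rw [hκE]
      nlinarith
    exact le_of_mul_le_mul_right h1 (by positivity)
  have hu : ‖u‖ ≤ M + κ := by linarith [norm_sub_norm_le u x]
  have hrpos : 0 < r := hrbar.trans_le hr
  have hv : v = r⁻¹ • (dualityMap x - dualityMap u) := by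
    rw [← hux, add_sub_cancel_left, smul_smul, inv_mul_cancel₀ hrpos.ne', one_smul]
  have h1 : (dualityMap x - dualityMap w) (u - w) ≤ rbar⁻¹ * (2 * κ) * (5 / 4 * (K + M)) := by
    have hmon := hT _ huv _ hw
    rw [sub_apply, sub_nonneg] at hmon
    refine hmon.trans ?_
    refine ((le_abs_self _).trans (v.le_opNorm _)).trans ?_
    gcongr
    · rw [hv, norm_smul, norm_inv, Real.norm_of_nonneg hrpos.le, norm_sub_rev]
      gcongr
    · refine (norm_sub_le _ _).trans ?_
      linarith
  have h2 : (dualityMap x - dualityMap w) (x - u) ≤ (K + M) * κ := by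
    refine ((le_abs_self _).trans ((dualityMap x - dualityMap w).le_opNorm _)).trans ?_
    gcongr
    · refine (norm_sub_le _ _).trans ?_
      rw [norm_dualityMap, norm_dualityMap]
      linarith
    · rw [norm_sub_rev]; linarith
  -- By the choice of E the two parts contribute at most 5l/8 and l/4.
  have h3 : (dualityMap x - dualityMap w) (x - w) < l := by
    rw [← sub_add_sub_cancel x u w, map_add]
    have h4 : κ * (rbar⁻¹ * (K + M)) ≤ κ * (E / 2) := by gcongr; linarith
    have h5 : κ * (K + M) ≤ κ * (E / 2) := by gcongr; linarith
    nlinarith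
  -- The sum of φ(x, w) and φ(w, x) is below 2l, so one of them is below l.
  have h4 := phi_add_phi x w
  rw [norm_sub_rev]
  refine norm_sub_lt_of_phi_lt hη h hL hM hε hx ?_
  by_contra! hcon
  linarith [hcon.1, hcon.2]

variable [CompleteSpace X] [UniformConvexSpace X]

theorem resolventMap_spec (hX : IsUniformlySmooth X) {T : Set (X × StrongDual ℝ X)}
    (hT : IsMaximallyMonotone T) (hne : T.Nonempty) {r : ℝ} (hr : 0 < r) (x : X) :
    ∃ v, (resolventMap T r x, v) ∈ T ∧ dualityMap (resolventMap T r x) + r • v = dualityMap x :=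
  Classical.epsilon_spec (p := fun u : X =>
    ∃ v : StrongDual ℝ X, (u, v) ∈ T ∧ dualityMap u + r • v = dualityMap x)
    (hT.exists_resolvent hX hne hr (dualityMap x))

theorem resolventMap_one_spec (hX : IsUniformlySmooth X) {T : Set (X × StrongDual ℝ X)}
    (hT : IsMaximallyMonotone T) (hne : T.Nonempty) (x : X) :
    (resolventMap T 1 x, dualityMap x - dualityMap (resolventMap T 1 x)) ∈ T := by
  obtain ⟨v, hv, h⟩ := resolventMap_spec hX hT hne one_pos x
  rwa [← h, one_smul, add_sub_cancel_left]

theorem resolventMap_eq (hX : IsUniformlySmooth X) {η : ℝ → ℝ}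
    (hη : IsConvexityModulus X η) [Nontrivial X] (h : Module.finrank ℝ X ≠ 1)
    {T : Set (X × StrongDual ℝ X)} (hT : IsMaximallyMonotone T) {r : ℝ} (hr : 0 < r)
    {u x : X} {v : StrongDual ℝ X} (huv : (u, v) ∈ T)
    (hux : dualityMap u + r • v = dualityMap x) : resolventMap T r x = u := by
  obtain ⟨v', hv', hx'⟩ := resolventMap_spec hX hT ⟨_, huv⟩ hr x
  refine eq_of_phi_nonpos hη h ?_
  have h1 := phi_add_phi (resolventMap T r x) u
  have h2 := hT.1 _ hv' _ huv
  have h3 : dualityMap (resolventMap T r x) - dualityMap u = -(r • (v' - v)) := by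
    rw [eq_sub_of_add_eq hx', eq_sub_of_add_eq hux]; module
  rw [h3, neg_apply, smul_apply, smul_eq_mul] at h1
  have h4 := phi_nonneg u (resolventMap T r x)
  have h5 := mul_nonneg hr.le h2
  simp only at h5
  linarith

theorem fixedPoints_resolventMap_one (hX : IsUniformlySmooth X) {η : ℝ → ℝ}
    (hη : IsConvexityModulus X η) [Nontrivial X] (h : Module.finrank ℝ X ≠ 1)
    {T : Set (X × StrongDual ℝ X)} (hT : IsMaximallyMonotone T) (hne : T.Nonempty) :
    {y | resolventMap T 1 y = y} = zer T := by
  ext y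
  constructor
  · intro hy
    have h1 := resolventMap_one_spec hX hT hne y
    rwa [show resolventMap T 1 y = y from hy, sub_self] at h1
  · intro hy
    exact resolventMap_eq hX hη h hT one_pos hy (by simp)

end Resolvent

/-! ### Fejér monotonicity and the rate for the iteration. -/

section Iteration

variable {X : Type*} [NormedAddCommGroup X] [NormedSpace ℝ X] [CompleteSpace X]
  [UniformConvexSpace X]

theorem IsMannPPA.phi_succ_le (hX : IsUniformlySmooth X) {T : Set (X × StrongDual ℝ X)}
    (hT : IsMaximallyMonotone T) {α r : ℕ → ℝ} {x : ℕ → X} (hx : IsMannPPA T α r x) {n : ℕ}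
    (hα0 : 0 ≤ α n) (hα1 : α n ≤ 1) (hr : 0 < r n) {p : X} (hp : p ∈ zer T) :
    phi p (x (n + 1)) ≤ phi p (x n) - (1 - α n) * phi (resolventMap T (r n) (x n)) (x n) := by
  obtain ⟨v, hv, hJ⟩ := resolventMap_spec hX hT ⟨_, hp⟩ hr (x n)
  have h1 := phi_add_phi_le hT.1 hr hv hJ hp
  have h2 := phi_le_of_dualityMap_eq hα0 hα1 (p := p) (hx n)
  nlinarith [mul_le_mul_of_nonneg_left h1 (sub_nonneg.2 hα1)]

theorem IsMannPPA.phi_antitone (hX : IsUniformlySmooth X) {T : Set (X × StrongDual ℝ X)}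
    (hT : IsMaximallyMonotone T) {α r : ℕ → ℝ} {x : ℕ → X} (hx : IsMannPPA T α r x)
    (hα0 : ∀ n, 0 ≤ α n) (hα1 : ∀ n, α n ≤ 1) (hr : ∀ n, 0 < r n) {p : X} (hp : p ∈ zer T) :
    Antitone fun n => phi p (x n) := by
  refine antitone_nat_of_succ_le fun n => ?_
  have h1 := hx.phi_succ_le hX hT (hα0 n) (hα1 n) (hr n) hp
  have h2 := mul_nonneg (sub_nonneg.2 (hα1 n)) (phi_nonneg (resolventMap T (r n) (x n)) (x n))
  linarith

theorem IsMannPPA.exists_phi_lt (hX : IsUniformlySmooth X) {T : Set (X × StrongDual ℝ X)}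
    (hT : IsMaximallyMonotone T) {α r : ℕ → ℝ} {x : ℕ → X} (hx : IsMannPPA T α r x)
    (hα0 : ∀ n, 0 ≤ α n) {αbar : ℝ} (hαbar : αbar < 1) (hα1 : ∀ n, α n ≤ αbar)
    (hr : ∀ n, 0 < r n) {p : X} (hp : p ∈ zer T) {b : ℝ} (hb : phi p (x 0) ≤ b)
    {l : ℝ} (hl : 0 < l) :
    ∃ n ≤ ⌈b / (l * (1 - αbar))⌉₊, phi (resolventMap T (r n) (x n)) (x n) < l := by
  by_contra! hcon
  set N := ⌈b / (l * (1 - αbar))⌉₊ with hN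
  have hpos : 0 < l * (1 - αbar) := mul_pos hl (by linarith)
  -- N steps only bring the bound down to at most 0; one more makes it negative, contradicting φ ≥
  -- 0.
  have key : ∀ n ≤ N + 1, phi p (x n) ≤ b - n * (l * (1 - αbar)) := by
    intro n
    induction n with
    | zero => intro _; simpa using hb
    | succ n ih =>
      intro hn
      have h1 := ih (by omega)
      have h2 := hx.phi_succ_le hX hT (hα0 n) ((hα1 n).trans hαbar.le) (hr n) hp
      have h3 := hcon n (by omega)
      have h4 : (1 - αbar) * l ≤ (1 - α n) * phi (resolventMap T (r n) (x n)) (x n) := by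
        have := hα1 n
        gcongr
        linarith
      push_cast
      linarith
  have h1 := key (N + 1) le_rfl
  have h2 := phi_nonneg p (x (N + 1))
  have h3 : b ≤ N * (l * (1 - αbar)) := by
    rw [← div_le_iff₀ hpos]
    exact Nat.le_ceil _
  push_cast at h1
  linarith

theorem IsMannPPA.norm_sub_lt (hX : IsUniformlySmooth X)
    (hdim : Module.finrank ℝ X ≠ 1) [Nontrivial X]
    {η : ℝ → ℝ} (hη : IsConvexityModulus X η)
    {ω : ℝ → ℝ → ℝ} (hω : IsDualityContinuityModulus X ω)
    {L : ℝ} (hL : 1 < L) (hL' : L < 3.18)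
    {T : Set (X × StrongDual ℝ X)} (hT : IsMaximallyMonotone T)
    {α r : ℕ → ℝ} (hα : ∀ n, 0 ≤ α n)
    {αbar : ℝ} (hαbar : αbar < 1) (hααbar : ∀ n, α n ≤ αbar)
    {rbar : ℝ} (hrbar : 0 < rbar) (hrrbar : ∀ n, rbar ≤ r n)
    {x : ℕ → X} (hx : IsMannPPA T α r x)
    {M : ℝ} (hM : ∀ n, ‖x n‖ ≤ M) {z : X} (hz : z ∈ zer T)
    {b : ℝ} (hb : phi z (x 0) ≤ b) {c : X} {d : StrongDual ℝ X} (hcd : (c, d) ∈ T)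
    {C D : ℝ} (hC : ‖c‖ ≤ C) (hD : ‖d‖ ≤ D) {E : ℝ}
    (hE : max (2 * (muBound C D 1 M + M))
        (2 * (rbar⁻¹ * muBound C D 1 M +
          max ((1 + C) * (rbar⁻¹ * M + D) + C) rbar⁻¹)) ≤ E)
    {ρ : ℝ → ℝ} (hρ : IsRegularityModulus T (Metric.closedBall 0 M) ρ)
    {δ : ℝ} (hδ : 0 < δ) {n m : ℕ}
    (hn : 2 * tau η ω L M E b αbar (rhoPrime ρ L M (theta η L M δ / 2)) ≤ n)
    (hm : 2 * tau η ω L M E b αbar (rhoPrime ρ L M (theta η L M δ / 2)) ≤ m) :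
    ‖x n - x m‖ < δ := by
  have hne : T.Nonempty := ⟨_, hz⟩
  have hM0 : 0 ≤ M := (norm_nonneg _).trans (hM 0)
  have hC0 : 0 ≤ C := (norm_nonneg _).trans hC
  have hD0 : 0 ≤ D := (norm_nonneg _).trans hD
  have hr0 : ∀ n, 0 < r n := fun n => hrbar.trans_le (hrrbar n)
  have hα1 : ∀ n, α n ≤ 1 := fun n => (hααbar n).trans hαbar.le
  have hK : 1 ≤ muBound C D 1 M := le_max_right _ _
  have hE₁ : 2 * (muBound C D 1 M + M) ≤ E := (le_max_left _ _).trans hE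
  have hE₂ : 2 * (rbar⁻¹ * (muBound C D 1 M + M)) ≤ E := by
    refine le_trans ?_ ((le_max_right _ _).trans hE)
    have h1 : rbar⁻¹ * M ≤ (1 + C) * (rbar⁻¹ * M + D) + C := by
      have : 0 ≤ C * (rbar⁻¹ * M + D) := by positivity
      linarith
    have h2 := le_max_left ((1 + C) * (rbar⁻¹ * M + D) + C) rbar⁻¹
    linarith
  have hEpos : 0 < E := by linarith
  have hθ : 0 < theta η L M δ := lambdaLow_pos hη hL hM0 (by positivity)
  have hθ' : theta η L M δ ≤ (M + 1) ^ 2 := lambdaLow_le_sq_radius hη hL hM0 (by positivity)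
  have hL0 : 0 < L := by linarith
  have hup : 0 < LambdaUp L M (theta η L M δ / 2 / 2) := by
    rw [LambdaUp]; positivity
  obtain ⟨hρ0, hρ1⟩ := hρ _ hup
  rw [rhoPrime] at hn hm
  set ε := ρ (LambdaUp L M (theta η L M δ / 2 / 2)) with hε
  have hl : 0 < lambdaLow η L M ε := lambdaLow_pos hη hL hM0 hρ0
  have hω0 : 0 < ω (lambdaLow η L M ε / (2 * E)) M := (hω _ M (by positivity) hM0).1.1
  obtain ⟨k, hk, hphi⟩ := hx.exists_phi_lt hX hT hα hαbar hααbar hr0 hz hb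
    (lambdaLow_pos hη hL hM0 hω0)
  have hkτ : k ≤ 2 * tau η ω L M E b αbar ε := by
    rw [tau]; omega
  obtain ⟨v, hv, hJ⟩ := resolventMap_spec hX hT hne (hr0 k) (x k)
  have hw := resolventMap_one_spec hX hT hne (x k)
  have hdist := norm_sub_resolvent_lt hX hη hdim hω hT.1 hL hM0 hρ0 hrbar (hrrbar k) hK hE₁ hE₂
    (hM k) hv hJ hw (norm_le_muBound hT.1 hw hcd hC hD (hM k)) hphi
  have hinf := hρ1 (x k) (mem_closedBall_zero_iff.2 (hM k)) hdist
  rw [fixedPoints_resolventMap_one hX hη hdim hT hne, Metric.infDist_lt_iff ⟨z, hz⟩] at hinf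
  obtain ⟨y, hy, hxy⟩ := hinf
  rw [dist_eq_norm] at hxy
  -- With t < θ(δ)L/(64(M + 1)), `phi_le` gives φ(y, x_k) ≤ 5(M + 1)t < (5L/64) θ(δ), and 5L/64 < 1.
  have hphiy : phi y (x k) < theta η L M δ := by
    have h1 := phi_le y (x k)
    set t := ‖x k - y‖ with ht
    have ht0 : 0 ≤ t := norm_nonneg _
    have h2 : t * (64 * (M + 1)) < theta η L M δ * L := by
      rw [LambdaUp, lt_div_iff₀ (by positivity)] at hxy
      have h3 := mul_lt_mul_of_pos_right hxy hL0
      have h4 : t * (16 * L⁻¹ * (M + 1)) * L = t * (16 * (M + 1)) := by field_simp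
      linarith
    have h3 : t ≤ M + 1 := by
      have h4 : theta η L M δ * L ≤ (M + 1) ^ 2 * 64 := by
        have : L ≤ 64 := by linarith
        gcongr
      by_contra! h5
      nlinarith
    have h4 : ‖y‖ ≤ M + t := by
      have := norm_sub_norm_le y (x k)
      rw [norm_sub_rev] at this
      linarith [hM k]
    have h5 : (‖y‖ + 3 * ‖x k‖) * t ≤ (5 * (M + 1)) * t := by
      gcongr
      linarith [hM k]
    norm_num at hL'
    nlinarith
  -- Fejér monotonicity with respect to the new zero y rather than z; θ(δ) is λ̃(δ/2).
  have hlt : ∀ j, 2 * tau η ω L M E b αbar ε ≤ j → ‖y - x j‖ < δ / 2 := fun j hj =>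
    norm_sub_lt_of_phi_lt hη hdim hL hM0 (by positivity) (hM j) (Or.inl
      ((hx.phi_antitone hX hT hα hα1 hr0 hy (hkτ.trans hj)).trans_lt hphiy))
  have h1 := hlt n hn
  have h2 := hlt m hm
  calc ‖x n - x m‖ = ‖(y - x m) - (y - x n)‖ := by rw [sub_sub_sub_cancel_left]
    _ ≤ ‖y - x m‖ + ‖y - x n‖ := norm_sub_le _ _
    _ < δ := by linarith

end Iteration

end MannPPA

theorem mainTheorem11 {X : Type*} [NormedAddCommGroup X] [NormedSpace ℝ X] [CompleteSpace X]
    [UniformConvexSpace X] (hsmooth : MannPPA.IsUniformlySmooth X)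
    (hdim : Module.finrank ℝ X ≠ 1)
    (η : ℝ → ℝ) (hη : MannPPA.IsConvexityModulus X η)
    (ω : ℝ → ℝ → ℝ) (hω : MannPPA.IsDualityContinuityModulus X ω)
    (L : ℝ) (hL : 1 < L) (hL' : L < 3.18)
    (T : Set (X × StrongDual ℝ X)) (hT : MannPPA.IsMaximallyMonotone T)
    (α r : ℕ → ℝ) (hα : ∀ n, 0 ≤ α n)
    (αbar : ℝ) (hαbar : αbar < 1) (hααbar : ∀ n, α n < αbar)
    (rbar : ℝ) (hrbar : 0 < rbar) (hrrbar : ∀ n, rbar ≤ r n)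
    (x : ℕ → X) (hx : MannPPA.IsMannPPA T α r x)
    (M : ℝ) (hM : ∀ n, ‖x n‖ ≤ M)
    (z : X) (hz : z ∈ MannPPA.zer T)
    (b : ℝ) (hb : MannPPA.phi z (x 0) ≤ b)
    (c : X) (d : StrongDual ℝ X) (hcd : (c, d) ∈ T)
    (C D : ℝ) (hC : ‖c‖ ≤ C) (hD : ‖d‖ ≤ D)
    (E : ℝ)
    (hE : max (2 * (MannPPA.muBound C D 1 M + M))
        (2 * (rbar⁻¹ * MannPPA.muBound C D 1 M +
          max ((1 + C) * (rbar⁻¹ * M + D) + C) rbar⁻¹)) ≤ E)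
    (ρ : ℝ → ℝ) (hρ : MannPPA.IsRegularityModulus T (Metric.closedBall 0 M) ρ) :
    CauchySeq x ∧
    (∀ δ : ℝ, 0 < δ → ∀ n m : ℕ,
      2 * MannPPA.tau η ω L M E b αbar
        (MannPPA.rhoPrime ρ L M (MannPPA.theta η L M δ / 2)) ≤ n →
      2 * MannPPA.tau η ω L M E b αbar
        (MannPPA.rhoPrime ρ L M (MannPPA.theta η L M δ / 2)) ≤ m →
      ‖x n - x m‖ < δ) ∧
    (∀ δ : ℝ, 0 < δ → (δ ≤ 1 ∨ MannPPA.lambdaLow η L M δ ≤ δ) → ∀ n m : ℕ,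
      2 * MannPPA.tau η ω L M E b αbar
        (MannPPA.rhoPrime ρ L M
          (MannPPA.theta η L M (MannPPA.lambdaLow η L M δ) / 2)) ≤ n →
      2 * MannPPA.tau η ω L M E b αbar
        (MannPPA.rhoPrime ρ L M
          (MannPPA.theta η L M (MannPPA.lambdaLow η L M δ) / 2)) ≤ m →
      ‖x n - x m‖ < δ) := by
  have hM0 : 0 ≤ M := (norm_nonneg _).trans (hM 0)
  have key : ∀ δ : ℝ, 0 < δ → ∀ n m : ℕ,
      2 * MannPPA.tau η ω L M E b αbar
        (MannPPA.rhoPrime ρ L M (MannPPA.theta η L M δ / 2)) ≤ n →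
      2 * MannPPA.tau η ω L M E b αbar
        (MannPPA.rhoPrime ρ L M (MannPPA.theta η L M δ / 2)) ≤ m →
      ‖x n - x m‖ < δ := by
    intro δ hδ n m hn hm
    rcases subsingleton_or_nontrivial X with hX | hX
    · rwa [Subsingleton.elim (x n) (x m), sub_self, norm_zero]
    · exact hx.norm_sub_lt hsmooth hdim hη hω hL hL' hT hα hαbar (fun n => (hααbar n).le) hrbar
        hrrbar hM hz hb hcd hC hD hE hρ hδ hn hm
  refine ⟨Metric.cauchySeq_iff.2 fun ε hε =>
    ⟨2 * MannPPA.tau η ω L M E b αbar (MannPPA.rhoPrime ρ L M (MannPPA.theta η L M ε / 2)),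
      fun m hm n hn => ?_⟩, key, ?_⟩
  · rw [dist_eq_norm]
    exact key ε hε m n hm hn
  · intro δ hδ hδ' n m hn hm
    rcases subsingleton_or_nontrivial X with hX | hX
    · rwa [Subsingleton.elim (x n) (x m), sub_self, norm_zero]
    · refine (key _ (MannPPA.lambdaLow_pos hη hL hM0 hδ) n m hn hm).trans_le ?_
      -- What remains is λ̃(δ) ≤ δ; for δ ≤ 1 the bound 9δ²/256 gives it.
      rcases hδ' with h1 | h1
      · have h2 := MannPPA.lambdaLow_le_sq hη hdim hL hM0 hδ (by linarith)
        nlinarith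
      · exact h1
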